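/- Let $\beta\omega$ be the Čech–Stone compactification of the discrete space $\omega$ of natural numbers, whose points are the ultrafilters on $\omega$, and let $\omega^*=\beta\omega\setminus\omega$ be the set of nonprincipal ultrafilters. Let $C(\beta\omega)$ be the Banach space of continuous real-valued functions on $\beta\omega$ with the supremum norm, and let $\tau_p$, $weak$ and $norm$ denote its pointwise, weak and norm topologies. For a topology $\tau$ on a set $X$, let $Bor(X,\tau)$ be the $\sigma$-algebra generated by the $\tau$-open sets, and let $Ba(X,\tau)$ be the smallest $\sigma$-algebra on $X$ making all $\tau$-continuous functions $X\to\mathbb R$ measurable. (1) Let $(A_\alpha)_{\alpha\in I}$ be an almost disjoint family of infinite subsets of $\omega$ (that is, $A_\alpha\cap A_{\alpha'}$ is finite whenever $\alpha\neq\alpha'$) indexed by an uncountable set $I$ (for example $I=\omega_1$), and for every $\alpha\in I$ let $\mathcal F_\alpha\in\omega^*$ be such that $A_\alpha\in\mathcal F_\alpha$. Then the set $$V=\{f\in C(\beta\omega): f(\mathcal F_\alpha)>0\text{ for some }\alpha\in I\}$$ is $\tau_p$-open, and $V\notin Ba(C(\beta\omega),weak)$. (2) $Bor(C(\beta\omega),\tau_p)\not\subseteq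 Ba(C(\beta\omega),weak)$. (3) All the following inclusions hold and are strict: $$Ba(C(\beta\omega),\tau_p)\subsetneq Bor(C(\beta\omega),\tau_p)\subsetneq Bor(C(\beta\omega),weak)\subsetneq Bor(C(\beta\omega),norm),$$ $$Ba(C(\beta\omega),\tau_p)\subsetneq Ba(C(\beta\omega),weak)\subsetneq Bor(C(\beta\omega),weak).$$ -/

import Mathlib

open scoped Topology MeasureTheory

/-- The Čech-Stone compactification `βω` of the discrete space `ω` of natural numbers, realized as
the space of all ultrafilters on `ω` with Mathlib's (Stone) topology. -/
abbrev BetaOmega : Type := Ultrafilter ℕ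

/-- The remainder `ω* = βω ∖ ω`: the nonprincipal ultrafilters. -/
def omegaStar : Set BetaOmega := (Set.range (pure : ℕ → Ultrafilter ℕ))ᶜ

/-- An (indexed) almost disjoint family of infinite subsets of `ω`. -/
def IsAlmostDisjointFamily {ι : Type*} (A : ι → Set ℕ) : Prop :=
  (∀ i, (A i).Infinite) ∧ ∀ i j, i ≠ j → (A i ∩ A j).Finite

/-- The supremum norm topology on `C(K)`. -/
@[reducible] noncomputable def normTopology (K : Type*) [TopologicalSpace K] [CompactSpace K] :
    TopologicalSpace C(K, ℝ) :=
  (PseudoMetricSpace.toUniformSpace : UniformSpace C(K, ℝ)).toTopologicalSpace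

/-- The weak topology on the Banach space `C(K)`. -/
@[reducible] noncomputable def weakTopology (K : Type*) [TopologicalSpace K] [CompactSpace K] :
    TopologicalSpace C(K, ℝ) :=
  TopologicalSpace.induced (toWeakSpace ℝ C(K, ℝ)) inferInstance

/-- The topology of pointwise convergence on `C(K)`. -/
@[reducible] noncomputable def pointwiseTopology (K : Type*) [TopologicalSpace K] :
    TopologicalSpace C(K, ℝ) :=
  TopologicalSpace.induced (fun (f : C(K, ℝ)) (x : K) => f x) Pi.topologicalSpace

/-- The Baire σ-algebra of a topological space `(X, t)`: the smallest σ-algebra on `X` making all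
`t`-continuous real-valued functions measurable. -/
@[reducible] noncomputable def baireSigmaAlgebra {X : Type*} (t : TopologicalSpace X) :
    MeasurableSpace X :=
  ⨆ f : {f : X → ℝ // @Continuous X ℝ t inferInstance f}, MeasurableSpace.comap f.1 (borel ℝ)

/-- The Borel σ-algebra of a topological space `(X, t)`. -/
@[reducible] noncomputable def borelSigmaAlgebra {X : Type*} (t : TopologicalSpace X) :
    MeasurableSpace X :=
  @borel X t

/-- The set of `f ∈ C(βω)` that are positive at some point of the family `(F i)`. -/
def positiveSomewhere {ι : Type*} (F : ι → BetaOmega) : Set C(BetaOmega, ℝ) :=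
  {f | ∃ i, 0 < f (F i)}

/-! ### Baire category in the Cantor space -/

/-! Borel subsets of the Cantor space have the Baire property, and this excludes Borel traces of
nonprincipal objects. By the zero-one law, a Borel finitely additive `ν` on `𝒫(N)` vanishing on
finite sets takes one value `c` on a comeager set; cutting a generic set by another gives `c = c +
c`, hence `ν N = 0`. Measurability in `C(βω)` is tested by pulling back along maps that send `x` to
the indicator of a set varying with `x`. Since a measurable set involves only countably many
generators, only countably many generators must be made Borel along such a map. Three witnesses
result.

The set `V`: by Edgar's theorem the weak Baire σ-algebra is generated by functionals. Each
functional is Borel on `𝒫(A i)` for all but countably many `i`, since almost disjoint sets are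
disjoint up to finite parts and a functional has bounded variation. For a good `i` the trace of `V`
is the ultrafilter `F i`, a nonzero two-valued measure on `𝒫(A i)`.

A functional `Λ` extending asymptotic density: a pointwise neighbourhood constrains finitely many
integers and finitely many nonprincipal ultrafilters, and the latter share a set of arbitrarily
small density. A fusion makes countably many pointwise open sets Borel on a cube over a set `N` with
sparse complement, so `Λ` would vanish at `N` although `N` has density at least one half.

A norm closed set: indicators are 1-separated, so any set of them is norm closed, in particular one
of fixed parity modulo finite sets. A similar fusion makes countably many weakly open sets clopen on
a cube over an infinite set, where parity lacks the Baire property.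

Comparison of the topologies gives the inclusions, and these witnesses give their strictness. -/

theorem exists_finset_cylinder_subset {U : Set (ℕ → Bool)} (hU : IsOpen U) {x : ℕ → Bool}
    (hx : x ∈ U) : ∃ I : Finset ℕ, ∀ y : ℕ → Bool, (∀ i ∈ I, y i = x i) → y ∈ U := by
  obtain ⟨I, u, hu, hsub⟩ := isOpen_pi_iff.1 hU x hx
  exact ⟨I, fun y hy => hsub fun i hi => by rw [hy i hi]; exact (hu i hi).2⟩

theorem tendsto_residual_piMap {α β : Type} [TopologicalSpace α] [DiscreteTopology α]
    [TopologicalSpace β] [DiscreteTopology β] (f : ℕ → α → β)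
    (hf : ∀ n, Function.Surjective (f n)) :
    Filter.Tendsto (Pi.map f) (residual (ℕ → α)) (residual (ℕ → β)) :=
  tendsto_residual_of_isOpenMap
    (continuous_pi fun n => (continuous_of_discreteTopology (f := f n)).comp (continuous_apply n))
    (IsOpenMap.piMap (fun _ _ _ => isOpen_discrete _) (Filter.Eventually.of_forall hf))

/-- Adding `c` coordinatewise modulo two. -/
def xorMap (c : ℕ → Bool) : (ℕ → Bool) → (ℕ → Bool) :=
  Pi.map fun n b => xor b (c n)

theorem tendsto_residual_xorMap (c : ℕ → Bool) :
    Filter.Tendsto (xorMap c) (residual (ℕ → Bool)) (residual (ℕ → Bool)) :=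
  tendsto_residual_piMap _ fun n b => ⟨xor b (c n), by cases b <;> cases c n <;> rfl⟩

/-- The topological zero-one law for tail sets with the Baire property. -/
theorem residual_zero_one {S : Set (ℕ → Bool)} (hS : BaireMeasurableSet S)
    (htail : ∀ x y : ℕ → Bool, {n | x n ≠ y n}.Finite → x ∈ S → y ∈ S) :
    (∀ᶠ x in residual (ℕ → Bool), x ∈ S) ∨ (∀ᶠ x in residual (ℕ → Bool), x ∉ S) := by
  obtain ⟨U, hU, hSU⟩ := hS.residualEq_isOpen
  have hSU' : ∀ᶠ x in residual (ℕ → Bool), (x ∈ S ↔ x ∈ U) := hSU.mem_iff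
  rcases U.eq_empty_or_nonempty with rfl | ⟨x₀, hx₀⟩
  · right
    filter_upwards [hSU'] with x hx
    simpa using hx
  · left
    obtain ⟨I, hI⟩ := exists_finset_cylinder_subset hU hx₀
    have hall : ∀ᶠ x in residual (ℕ → Bool), ∀ t ∈ I.powerset,
        (xorMap (fun n => decide (n ∈ t)) x ∈ S ↔ xorMap (fun n => decide (n ∈ t)) x ∈ U) := by
      rw [Filter.eventually_all_finset]
      exact fun t _ => (tendsto_residual_xorMap _).eventually hSU'
    filter_upwards [hall] with x hx
    -- Flipping `x` on the coordinates of `I` where it differs from `x₀` lands in the cylinder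
    -- inside `U`; tail invariance then returns to `x`.
    have key := hx (I.filter fun n => x n ≠ x₀ n) (by simp)
    refine htail _ x (I.finite_toSet.subset ?_) (key.2 (hI _ fun i hi => ?_))
    · intro n hn
      by_contra hnI
      simp only [Finset.mem_coe] at hnI
      simp [xorMap, hnI] at hn
    · simp only [xorMap, Pi.map_apply, Finset.mem_filter, hi, true_and]
      cases x i <;> cases x₀ i <;> rfl

/-- A set that every change of a single coordinate exchanges with its complement does not have the
Baire property. -/
theorem not_baireMeasurableSet_of_parity {Z : Set (ℕ → Bool)}
    (hZ : ∀ (x : ℕ → Bool) (n : ℕ), Function.update x n (!x n) ∈ Z ↔ x ∉ Z) :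
    ¬ BaireMeasurableSet Z := by
  intro h
  obtain ⟨U, hU, hZU⟩ := h.residualEq_isOpen
  have hZU' : ∀ᶠ x in residual (ℕ → Bool), (x ∈ Z ↔ x ∈ U) := hZU.mem_iff
  have hflip : ∀ n : ℕ, ∀ᶠ x in residual (ℕ → Bool), (x ∉ Z ↔ Function.update x n (!x n) ∈ U) := by
    intro n
    have := (tendsto_residual_xorMap fun k => decide (k = n)).eventually hZU'
    filter_upwards [this] with x hx
    have e : xorMap (fun k => decide (k = n)) x = Function.update x n (!x n) := by
      funext k
      by_cases hk : k = n
      · subst hk; simp [xorMap]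
      · simp [xorMap, hk]
    rw [e, hZ] at hx
    exact hx
  rcases U.eq_empty_or_nonempty with rfl | ⟨x₀, hx₀⟩
  · obtain ⟨x, hx⟩ := (dense_of_mem_residual (hZU'.and (hflip 0))).nonempty
    simp only [Set.mem_empty_iff_false, iff_false, Set.mem_ofPred_eq] at hx
    exact hx.2 hx.1
  · obtain ⟨I, hI⟩ := exists_finset_cylinder_subset hU hx₀
    -- Flipping a coordinate outside `I` stays in the cylinder, so a generic point there and its
    -- flip would both lie in `Z`.
    obtain ⟨n, hn⟩ := Infinite.exists_notMem_finset I
    obtain ⟨O, hO, hxO, hOI⟩ : ∃ O : Set (ℕ → Bool), IsOpen O ∧ x₀ ∈ O ∧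
        ∀ y ∈ O, ∀ i ∈ I, y i = x₀ i :=
      ⟨(I : Set ℕ).pi fun i => {x₀ i}, isOpen_set_pi I.finite_toSet fun _ _ => isOpen_discrete _,
        fun i _ => rfl, fun y hy i hi => hy i hi⟩
    obtain ⟨x, hxO', hx⟩ :=
      (dense_of_mem_residual (hZU'.and (hflip n))).inter_open_nonempty O hO ⟨x₀, hxO⟩
    refine hx.2.2 (hI _ fun i hi => ?_) (hx.1.2 (hI _ (hOI x hxO')))
    rw [Function.update_of_ne (ne_of_mem_of_not_mem hi hn)]
    exact hOI x hxO' i hi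

/-- The subset of `ℕ` coded by a point of the Cantor space. -/
def codedSet (x : ℕ → Bool) : Set ℕ := {n | x n = true}

/-- A finitely additive function on `𝒫(ℕ)` that vanishes on finite sets and is Borel on the subsets
of `N` vanishes at `N`. -/
theorem eq_zero_of_measurable_of_additive (ν : Set ℕ → ℝ)
    (hadd : ∀ B C : Set ℕ, Disjoint B C → ν (B ∪ C) = ν B + ν C)
    (hfin : ∀ B : Set ℕ, B.Finite → ν B = 0) (N : Set ℕ)
    (hmeas : Measurable fun x : ℕ → Bool => ν (codedSet x ∩ N)) : ν N = 0 := by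
  have hdiff : ∀ B C : Set ℕ, B ⊆ C → (C \ B).Finite → ν B = ν C := by
    intro B C hBC hf
    have := hadd B (C \ B) Set.disjoint_sdiff_right
    rw [Set.union_sdiff_cancel hBC, hfin _ hf, add_zero] at this
    exact this.symm
  have htail : ∀ x y : ℕ → Bool, {n | x n ≠ y n}.Finite →
      ν (codedSet x ∩ N) = ν (codedSet y ∩ N) := by
    intro x y hxy
    rw [← hdiff (codedSet x ∩ codedSet y ∩ N) (codedSet x ∩ N),
      ← hdiff (codedSet x ∩ codedSet y ∩ N) (codedSet y ∩ N)]
    · rintro n ⟨⟨-, h1⟩, h2⟩; exact ⟨h1, h2⟩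
    · refine hxy.subset ?_
      rintro n ⟨⟨h1, h2⟩, h3⟩ h4
      simp only [codedSet, Set.mem_ofPred_eq] at h1
      exact h3 ⟨⟨h4.trans h1, h1⟩, h2⟩
    · rintro n ⟨⟨h1, -⟩, h2⟩; exact ⟨h1, h2⟩
    · refine hxy.subset ?_
      rintro n ⟨⟨h1, h2⟩, h3⟩ h4
      simp only [codedSet, Set.mem_ofPred_eq] at h1
      exact h3 ⟨⟨h1, h4.symm.trans h1⟩, h2⟩
  obtain ⟨c, hc⟩ := Filter.exists_eventuallyEq_const_of_forall_separating
    (l := residual (ℕ → Bool)) (f := fun x => ν (codedSet x ∩ N)) MeasurableSet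
    fun U hU => residual_zero_one (S := (fun x => ν (codedSet x ∩ N)) ⁻¹' U) (hmeas hU).baireMeasurableSet fun x y hxy hx => by
      rw [Set.mem_preimage] at hx ⊢
      rwa [← htail x y hxy]
  have hc' : ∀ᶠ x in residual (ℕ → Bool), ν (codedSet x ∩ N) = c := hc
  -- For a generic pair of sets, the first set, its complement, and its two pieces cut by the second
  -- set are all generic. The pieces give `c = c + c`, and the complement gives `ν N = c + c`.
  have hop : ∀ op : Bool × Bool → Bool, Function.Surjective op →
      ∀ᶠ p in residual (ℕ → Bool × Bool), ν (codedSet (fun n => op (p n)) ∩ N) = c :=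
    fun op h => (tendsto_residual_piMap (fun _ => op) fun _ => h).eventually hc'
  have h1 := hop Prod.fst Prod.fst_surjective
  have h2 := hop (fun b => b.1 && b.2) (by decide)
  have h3 := hop (fun b => b.1 && !b.2) (by decide)
  have h4 := hop (fun b => !b.1) (by decide)
  obtain ⟨p, hp1, hp2, hp3, hp4⟩ :=
    (dense_of_mem_residual (h1.and (h2.and (h3.and h4)))).nonempty
  have e1 := hadd (codedSet (fun n => (p n).1 && (p n).2) ∩ N)
    (codedSet (fun n => (p n).1 && !(p n).2) ∩ N) (by
      rw [Set.disjoint_left]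
      rintro n ⟨h, -⟩ ⟨h', -⟩
      simp only [codedSet, Set.mem_ofPred_eq, Bool.and_eq_true, Bool.not_eq_true'] at h h'
      simp [h.2] at h')
  have e2 := hadd (codedSet (fun n => (p n).1) ∩ N) (codedSet (fun n => !(p n).1) ∩ N) (by
      rw [Set.disjoint_left]
      rintro n ⟨h, -⟩ ⟨h', -⟩
      simp only [codedSet, Set.mem_ofPred_eq] at h h'
      simp [h] at h')
  have s1 : codedSet (fun n => (p n).1 && (p n).2) ∩ N ∪
      codedSet (fun n => (p n).1 && !(p n).2) ∩ N = codedSet (fun n => (p n).1) ∩ N := by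
    ext n
    simp only [codedSet, Set.mem_union, Set.mem_inter_iff, Set.mem_ofPred_eq]
    cases (p n).1 <;> cases (p n).2 <;> simp
  have s2 : codedSet (fun n => (p n).1) ∩ N ∪ codedSet (fun n => !(p n).1) ∩ N = N := by
    ext n
    simp only [codedSet, Set.mem_union, Set.mem_inter_iff, Set.mem_ofPred_eq]
    cases (p n).1 <;> simp
  rw [s1] at e1
  rw [s2] at e2
  linarith

/-! ### Continuous functions on dense subspaces of powers of the line -/

/-- The box in `ℝ^B` coded by a finite set of coordinates and a set for each of them. -/
def codedBox {B : Type*} (c : Finset B × (B → Set ℝ)) : Set (B → ℝ) :=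
  (c.1 : Set B).pi c.2

/-- Powers of the line have the countable chain condition. -/
theorem countable_of_pairwiseDisjoint_codedBox {B : Type*} {S : Set (Finset B × (B → Set ℝ))}
    (hopen : ∀ c ∈ S, ∀ b ∈ c.1, IsOpen (c.2 b)) (hne : ∀ c ∈ S, (codedBox c).Nonempty)
    (hdisj : S.PairwiseDisjoint codedBox) : S.Countable := by
  -- A product of Gaussian measures charges every nonempty open box, and a probability measure
  -- admits only countably many disjoint sets of positive measure.
  let μ : MeasureTheory.Measure (B → ℝ) :=
    MeasureTheory.Measure.infinitePi fun _ => ProbabilityTheory.gaussianReal 0 1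
  have hpos : ∀ i : S, 0 < μ (codedBox i.1) := by
    intro i
    simp only [μ, codedBox]
    rw [MeasureTheory.Measure.infinitePi_pi _ fun b hb => (hopen _ i.2 b hb).measurableSet]
    refine pos_iff_ne_zero.2 (Finset.prod_ne_zero_iff.2 fun b hb h => ?_)
    obtain ⟨g, hg⟩ := hne _ i.2
    exact ((hopen _ i.2 b hb).measure_pos MeasureTheory.volume ⟨g b, hg b hb⟩).ne'
      (ProbabilityTheory.gaussianReal_absolutelyContinuous' 0 one_ne_zero h)
  have := MeasureTheory.Measure.countable_meas_pos_of_disjoint_iUnion (μ := μ)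
    (As := fun i : S => codedBox i.1)
    (fun i => MeasurableSet.pi i.1.1.countable_toSet fun b hb => (hopen _ i.2 b hb).measurableSet)
    (fun i j hij => hdisj i.2 j.2 fun h => hij (Subtype.ext h))
  have huniv : {i : S | 0 < μ (codedBox i.1)} = Set.univ := Set.eq_univ_of_forall hpos
  rw [huniv, Set.countable_univ_iff] at this
  exact Set.countable_coe_iff.1 this

/-- A maximal disjoint family of nonempty open boxes with property `Q` meets every further such box,
and the countable chain condition makes it countable. -/
theorem exists_countable_predense_codedBox {B : Type*} (Q : Finset B × (B → Set ℝ) → Prop) :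
    ∃ S : Set (Finset B × (B → Set ℝ)), S.Countable ∧
      (∀ c ∈ S, (∀ b ∈ c.1, IsOpen (c.2 b)) ∧ Q c) ∧
      ∀ c, (∀ b ∈ c.1, IsOpen (c.2 b)) → (codedBox c).Nonempty → Q c →
        ∃ c' ∈ S, (codedBox c ∩ codedBox c').Nonempty := by
  obtain ⟨S, hS⟩ := zorn_subset
    {S : Set (Finset B × (B → Set ℝ)) |
      (∀ c ∈ S, (∀ b ∈ c.1, IsOpen (c.2 b)) ∧ (codedBox c).Nonempty ∧ Q c) ∧
        S.PairwiseDisjoint codedBox} (by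
      intro C hC hchain
      refine ⟨⋃₀ C, ⟨?_, ?_⟩, fun s hs => Set.subset_sUnion_of_mem hs⟩
      · rintro c ⟨s, hs, hc⟩
        exact (hC hs).1 c hc
      · exact (Set.pairwiseDisjoint_sUnion hchain.directedOn).2 fun s hs => (hC hs).2)
  refine ⟨S, countable_of_pairwiseDisjoint_codedBox (fun c hc => (hS.1.1 c hc).1)
    (fun c hc => (hS.1.1 c hc).2.1) hS.1.2, fun c hc => ⟨(hS.1.1 c hc).1, (hS.1.1 c hc).2.2⟩, ?_⟩
  intro c hopen hne hQ
  by_contra! hcon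
  have hmem : c ∈ S := by
    refine hS.2 (y := insert c S) ⟨?_, ?_⟩ (Set.subset_insert _ _) (Set.mem_insert _ _)
    · rintro d (rfl | hd)
      · exact ⟨hopen, hne, hQ⟩
      · exact hS.1.1 d hd
    · exact hS.1.2.insert fun d hd _ => Set.disjoint_iff_inter_eq_empty.2 (hcon d hd)
  exact hne.ne_empty (by simpa using hcon c hmem)

/-- If finitely many coordinates can be prescribed arbitrarily, every continuous real function for
the topology of the coordinates is measurable for the σ-algebra of the coordinates. -/
theorem measurable_of_continuous_induced {E B : Type*} (Φ : E → B → ℝ)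
    (hΦ : ∀ (t : Finset B) (v : B → ℝ), ∃ x, ∀ b ∈ t, Φ x b = v b) {f : E → ℝ}
    (hf : @Continuous E ℝ (TopologicalSpace.induced Φ Pi.topologicalSpace) inferInstance f) :
    Measurable[⨆ b, MeasurableSpace.comap (fun x => Φ x b) (borel ℝ)] f := by
  classical
  have hnhd : ∀ O : Set ℝ, IsOpen O → ∀ x, f x ∈ O → ∃ c : Finset B × (B → Set ℝ),
      (∀ b ∈ c.1, IsOpen (c.2 b)) ∧ Φ x ∈ codedBox c ∧ ∀ y, Φ y ∈ codedBox c → f y ∈ O := by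
    intro O hO x hx
    obtain ⟨W, hW, hWO⟩ := isOpen_induced_iff.1 (@IsOpen.preimage E ℝ
      (TopologicalSpace.induced Φ Pi.topologicalSpace) _ f hf O hO)
    have hxW : Φ x ∈ W := by
      have : x ∈ Φ ⁻¹' W := by rw [hWO]; exact hx
      exact this
    obtain ⟨t, u, htu, hsub⟩ := isOpen_pi_iff.1 hW _ hxW
    refine ⟨(t, u), fun b hb => (htu b hb).1, fun b hb => (htu b hb).2, fun y hy => ?_⟩
    have : y ∈ Φ ⁻¹' W := hsub hy
    rw [hWO] at this
    exact this
  -- For each rational `q`, countably many boxes are predense among those where `f > q`. The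
  -- countable set `S` of their coordinates determines `f`.
  choose H hHc hH hHdense using fun q : ℚ => exists_countable_predense_codedBox
    fun c : Finset B × (B → Set ℝ) => ∀ y, Φ y ∈ codedBox c → (q : ℝ) < f y
  let S : Set B := ⋃ q, ⋃ c ∈ H q, (c.1 : Set B)
  have hSc : S.Countable := Set.countable_iUnion fun q =>
    (hHc q).biUnion fun c _ => c.1.countable_toSet
  have hcS : ∀ q, ∀ c ∈ H q, ∀ b ∈ c.1, b ∈ S := fun q c hc b hb =>
    Set.mem_iUnion.2 ⟨q, Set.mem_iUnion₂.2 ⟨c, hc, hb⟩⟩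
  let π : E → S → ℝ := fun x b => Φ x b
  have key : ∀ p x, f x < p → ∃ O : Set (S → ℝ), IsOpen O ∧ π x ∈ O ∧
      ∀ y, π y ∈ O → f y < p := by
    intro p x hx
    obtain ⟨q, hxq, hqp⟩ := exists_rat_btwn hx
    obtain ⟨c, hc, hxc, hcq⟩ := hnhd (Set.Iio (q : ℝ)) isOpen_Iio x hxq
    refine ⟨(((c.1.subtype (· ∈ S) : Finset S) : Set S)).pi fun b => c.2 b,
      isOpen_set_pi (Finset.finite_toSet _) fun b hb => hc b (by simpa using hb),
      fun b hb => hxc b (by simpa using hb), fun y hy => ?_⟩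
    by_contra! hpy
    obtain ⟨d, hd, hyd, hdq⟩ := hnhd (Set.Ioi (q : ℝ)) isOpen_Ioi y (hqp.trans_le hpy)
    -- This box combines `d`, where `f > q`, with the `S`-part of `c`, where `f < q`. By predensity
    -- it meets a box `e` of `H q`, supported in `S`.
    let d' : Finset B × (B → Set ℝ) :=
      (d.1 ∪ c.1.filter (· ∈ S), fun b =>
        (if b ∈ d.1 then d.2 b else Set.univ) ∩
          (if b ∈ c.1.filter (· ∈ S) then c.2 b else Set.univ))
    have hd'1 : ∀ g ∈ codedBox d', g ∈ codedBox d := fun g hg b hb => by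
      have := (hg b (Finset.mem_coe.2 (Finset.mem_union_left _ hb))).1
      rwa [if_pos (Finset.mem_coe.1 hb)] at this
    have hd'2 : ∀ g ∈ codedBox d', ∀ b ∈ c.1, b ∈ S → g b ∈ c.2 b := fun g hg b hb hbS => by
      have hm : b ∈ c.1.filter (· ∈ S) := Finset.mem_filter.2 ⟨hb, hbS⟩
      have := (hg b (Finset.mem_coe.2 (Finset.mem_union_right _ hm))).2
      rwa [if_pos hm] at this
    have hyd' : Φ y ∈ codedBox d' := by
      intro b _
      refine ⟨?_, ?_⟩
      · split_ifs with h
        · exact hyd b h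
        · trivial
      · split_ifs with h
        · have h' := Finset.mem_filter.1 h
          exact hy ⟨b, h'.2⟩ (by simpa using h'.1)
        · trivial
    obtain ⟨e, he, g, hgd, hge⟩ := hHdense q d' (by
        intro b _
        refine IsOpen.inter ?_ ?_
        · split_ifs with h
          · exact hd b h
          · exact isOpen_univ
        · split_ifs with h
          · exact hc b (Finset.mem_filter.1 h).1
          · exact isOpen_univ) ⟨_, hyd'⟩ fun z hz => hdq z (hd'1 _ hz)
    -- Following `g` on `S` and `x` off `S` puts `z` in both `c` and `e`, so that `f z < q < f z`.
    obtain ⟨z, hz⟩ := hΦ (c.1 ∪ e.1) fun b => if b ∈ S then g b else Φ x b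
    have hzc : Φ z ∈ codedBox c := by
      intro b hb
      rw [hz b (Finset.mem_union_left _ hb)]
      split_ifs with h
      · exact hd'2 g hgd b hb h
      · exact hxc b hb
    have hze : Φ z ∈ codedBox e := by
      intro b hb
      rw [hz b (Finset.mem_union_right _ hb), if_pos (hcS q e he b hb)]
      exact hge b hb
    exact lt_asymm (hcq z hzc) ((hH q e he).2 z hze)
  have := hSc.to_subtype
  let mE : MeasurableSpace E := ⨆ b, MeasurableSpace.comap (fun x => Φ x b) (borel ℝ)
  have hπ : Measurable π := measurable_pi_iff.2 fun b => by
    refine Measurable.mono (comap_measurable fun x => Φ x b)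
      (le_iSup (fun b => MeasurableSpace.comap (fun x => Φ x b) (borel ℝ)) b.1) ?_
    exact (BorelSpace.measurable_eq (α := ℝ)).le
  refine measurable_of_Iio fun p => ?_
  choose! O hO hxO hOp using key p
  have heq : f ⁻¹' Set.Iio p = π ⁻¹' ⋃ x ∈ f ⁻¹' Set.Iio p, O x := by
    ext y
    simp only [Set.mem_preimage, Set.mem_iUnion, Set.mem_Iio]
    exact ⟨fun hy => ⟨y, hy, hxO y hy⟩, fun ⟨x, hx, hy⟩ => hOp x hx y hy⟩
  rw [heq]
  exact hπ (isOpen_biUnion fun x hx => hO x hx).measurableSet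

/-- Were the joint range of the `φ b` a proper subspace of `ℝ^t`, a nonzero functional vanishing on
it would be a linear relation among them. -/
theorem exists_forall_eq_of_linearIndependent {E B : Type*} [AddCommGroup E] [Module ℝ E]
    {φ : B → E →ₗ[ℝ] ℝ} (hφ : LinearIndependent ℝ φ) (t : Finset B) (v : B → ℝ) :
    ∃ x, ∀ b ∈ t, φ b x = v b := by
  classical
  have hsurj : LinearMap.range (LinearMap.pi fun b : t => φ b) = ⊤ := by
    by_contra h
    obtain ⟨g, hg0, hg⟩ := Submodule.exists_le_ker_of_lt_top _ (lt_top_iff_ne_top.2 h)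
    refine hg0 (LinearMap.pi_ext' fun b => LinearMap.ext_ring ?_)
    have hlin := Fintype.linearIndependent_iff.1 (hφ.comp (fun b : t => b.1) Subtype.val_injective)
      (fun b => g (Pi.single b 1)) (by
        ext x
        have hx : g (LinearMap.pi (fun b : t => φ b) x) = 0 := hg ⟨x, rfl⟩
        rw [← Finset.univ_sum_single (LinearMap.pi (fun b : t => φ b) x), map_sum] at hx
        simp only [LinearMap.coe_sum, Finset.sum_apply, LinearMap.smul_apply, Function.comp_apply,
          LinearMap.zero_apply, smul_eq_mul]
        rw [← hx]
        refine Finset.sum_congr rfl fun b _ => ?_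
        rw [mul_comm, ← smul_eq_mul, ← map_smul, ← Pi.single_smul, smul_eq_mul, mul_one]
        rfl)
    simpa using hlin b
  obtain ⟨x, hx⟩ := LinearMap.range_eq_top.1 hsurj fun b => v b
  exact ⟨x, fun b hb => congrFun hx ⟨b, hb⟩⟩

/-- Edgar's theorem: the Baire σ-algebra of a weak topology is generated by the functionals. -/
theorem baireSigmaAlgebra_weakTopology_le (K : Type*) [TopologicalSpace K] [CompactSpace K] :
    baireSigmaAlgebra (weakTopology K) ≤
      ⨆ φ : C(K, ℝ) →L[ℝ] ℝ, MeasurableSpace.comap φ (borel ℝ) := by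
  refine iSup_le fun ⟨f, hf⟩ => ?_
  -- A Hamel basis of the dual suffices to generate the weak topology, and by independence finitely
  -- many of its values can be prescribed.
  let b := Module.Basis.ofVectorSpace ℝ (C(K, ℝ) →L[ℝ] ℝ)
  let Φ : C(K, ℝ) → Module.Basis.ofVectorSpaceIndex ℝ (C(K, ℝ) →L[ℝ] ℝ) → ℝ := fun x i => b i x
  have hle : TopologicalSpace.induced Φ Pi.topologicalSpace ≤ weakTopology K := by
    let : TopologicalSpace C(K, ℝ) := TopologicalSpace.induced Φ Pi.topologicalSpace
    rw [← continuous_iff_le_induced]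
    refine WeakBilin.continuous_of_continuous_eval _ fun φ => ?_
    change Continuous fun x : C(K, ℝ) => φ x
    have hcoord : ∀ i, Continuous fun x => Φ x i := fun i =>
      (continuous_apply i).comp (continuous_induced_dom (f := Φ))
    have : ∀ x : C(K, ℝ), φ x = (b.repr φ).sum fun i r => r * Φ x i := by
      intro x
      conv_lhs => rw [← b.linearCombination_repr φ]
      simp [Finsupp.linearCombination_apply, Finsupp.sum, Φ]
    simp_rw [this, Finsupp.sum]
    exact continuous_finsetSum _ fun i _ => continuous_const.mul (hcoord i)
  have hind : LinearIndependent ℝ fun i => ((b i : C(K, ℝ) →L[ℝ] ℝ) : C(K, ℝ) →ₗ[ℝ] ℝ) :=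
    b.linearIndependent.map' (ContinuousLinearMap.coeLM ℝ)
      (LinearMap.ker_eq_bot.2 ContinuousLinearMap.coe_injective)
  have hmeas := measurable_of_continuous_induced Φ
    (fun t v => exists_forall_eq_of_linearIndependent hind t v)
    (@Continuous.comp _ _ _ (_) (weakTopology K) _ id f hf (continuous_id_iff_le.2 hle))
  refine (MeasurableSpace.comap_mono (BorelSpace.measurable_eq (α := ℝ)).ge).trans
    (hmeas.comap_le.trans (iSup_le fun i => ?_))
  exact le_iSup (fun φ : C(K, ℝ) →L[ℝ] ℝ => MeasurableSpace.comap φ (borel ℝ)) (b i)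

/-! ### Indicators of sets of natural numbers -/

theorem isClopen_mem_ultrafilter (A : Set ℕ) : IsClopen {F : BetaOmega | A ∈ F} :=
  ⟨ultrafilter_isClosed_basic A, ultrafilter_isOpen_basic A⟩

/-- The indicator in `C(βω)` of the clopen set of ultrafilters containing `A`. -/
noncomputable def betaIndicator (A : Set ℕ) : C(BetaOmega, ℝ) :=
  (LocallyConstant.charFn ℝ (U := {F : BetaOmega | A ∈ F})
    (isClopen_mem_ultrafilter A)).toContinuousMap

open Classical in
theorem betaIndicator_apply (A : Set ℕ) (F : BetaOmega) :
    betaIndicator A F = if A ∈ F then 1 else 0 := by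
  change LocallyConstant.charFn ℝ (isClopen_mem_ultrafilter A) F = _
  rw [LocallyConstant.coe_charFn, Set.indicator_apply]
  rfl

theorem betaIndicator_union {A B : Set ℕ} (h : Disjoint A B) :
    betaIndicator (A ∪ B) = betaIndicator A + betaIndicator B := by
  classical
  ext F
  simp only [ContinuousMap.add_apply, betaIndicator_apply, Ultrafilter.union_mem_iff]
  by_cases hA : A ∈ F <;> by_cases hB : B ∈ F <;> simp [hA, hB]
  exact F.empty_notMem ((Set.disjoint_iff_inter_eq_empty.1 h) ▸ F.inter_mem hA hB)

theorem betaIndicator_sdiff_add_inter (A B : Set ℕ) :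
    betaIndicator A = betaIndicator (A \ B) + betaIndicator (A ∩ B) := by
  rw [← betaIndicator_union Set.disjoint_sdiff_inter, Set.sdiff_union_inter]

theorem notMem_of_finite_of_mem_omegaStar {F : BetaOmega} (hF : F ∈ omegaStar) {B : Set ℕ}
    (hB : B.Finite) : B ∉ F := fun h => by
  obtain ⟨n, -, rfl⟩ := Ultrafilter.eq_pure_of_finite_mem hB h
  exact hF ⟨n, rfl⟩

/-- Test `φ` on the signed sum of the indicators: an ultrafilter contains at most one of the
disjoint sets, so this sum has norm at most one. -/
theorem sum_abs_betaIndicator_le {ι : Type*} (φ : C(BetaOmega, ℝ) →L[ℝ] ℝ) (T : Finset ι)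
    (P : ι → Set ℕ) (hP : (T : Set ι).PairwiseDisjoint P) :
    ∑ i ∈ T, |φ (betaIndicator (P i))| ≤ ‖φ‖ := by
  classical
  let f : C(BetaOmega, ℝ) :=
    ∑ i ∈ T, (SignType.sign (φ (betaIndicator (P i))) : ℝ) • betaIndicator (P i)
  have hf : ‖f‖ ≤ 1 := by
    refine (ContinuousMap.norm_le _ zero_le_one).2 fun F => ?_
    simp only [f, ContinuousMap.coe_sum, Finset.sum_apply, ContinuousMap.smul_apply,
      betaIndicator_apply, smul_eq_mul]
    by_cases h : ∃ i ∈ T, P i ∈ F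
    · obtain ⟨i, hi, hiF⟩ := h
      rw [Finset.sum_eq_single_of_mem i hi fun j hj hji => ?_]
      · rw [if_pos hiF, mul_one]
        rcases SignType.sign (φ (betaIndicator (P i))) with _ | _ | _ <;> simp
      · rw [if_neg, mul_zero]
        exact fun hjF => F.empty_notMem
          ((Set.disjoint_iff_inter_eq_empty.1 (hP hj hi hji)) ▸ F.inter_mem hjF hiF)
    · push Not at h
      rw [Finset.sum_eq_zero fun i hi => by rw [if_neg (h i hi), mul_zero]]
      simp
  calc ∑ i ∈ T, |φ (betaIndicator (P i))| = φ f := by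
        simp only [f, map_sum, map_smul, smul_eq_mul]
        exact Finset.sum_congr rfl fun i _ => (sign_mul_self _).symm
    _ ≤ ‖φ f‖ := Real.le_norm_self _
    _ ≤ ‖φ‖ * ‖f‖ := φ.le_opNorm f
    _ ≤ ‖φ‖ := mul_le_of_le_one_right φ.opNorm_nonneg hf

theorem card_mul_le_norm {ι : Type*} (φ : C(BetaOmega, ℝ) →L[ℝ] ℝ) (T : Finset ι)
    (P : ι → Set ℕ) (hP : (T : Set ι).PairwiseDisjoint P) {ε : ℝ}
    (hε : ∀ i ∈ T, ε ≤ |φ (betaIndicator (P i))|) : T.card * ε ≤ ‖φ‖ := by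
  rw [← nsmul_eq_mul]
  exact (Finset.card_nsmul_le_sum _ _ _ hε).trans (sum_abs_betaIndicator_le φ T P hP)

/-- A function of finitely many coordinates on the Cantor space is measurable. -/
theorem measurable_of_finset_coordinates {α : Type*} [MeasurableSpace α] {g : (ℕ → Bool) → α}
    (I : Finset ℕ) (hg : ∀ x y : ℕ → Bool, (∀ i ∈ I, x i = y i) → g x = g y) : Measurable g := by
  classical
  let h : (I → Bool) → α := fun y => g fun n => if hn : n ∈ I then y ⟨n, hn⟩ else false
  have hgh : g = h ∘ fun (x : ℕ → Bool) (i : I) => x i :=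
    funext fun x => hg _ _ fun i hi => by simp [hi]
  rw [hgh]
  exact (measurable_of_finite h).comp (measurable_pi_iff.2 fun i => measurable_pi_apply _)

theorem exists_countable_measurableSet_generateFrom {α : Type*} {G : Set (Set α)} {s : Set α}
    (hs : MeasurableSet[MeasurableSpace.generateFrom G] s) :
    ∃ C ⊆ G, C.Countable ∧ MeasurableSet[MeasurableSpace.generateFrom C] s := by
  induction hs with
  | basic u hu => exact ⟨{u}, by simpa using hu, Set.countable_singleton u,
      MeasurableSpace.measurableSet_generateFrom (Set.mem_singleton u)⟩
  | empty => exact ⟨∅, Set.empty_subset _, Set.countable_empty,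
      @MeasurableSet.empty _ (MeasurableSpace.generateFrom _)⟩
  | compl t _ ih =>
    obtain ⟨C, hC, hCc, h⟩ := ih
    exact ⟨C, hC, hCc, @MeasurableSet.compl _ _ (MeasurableSpace.generateFrom _) h⟩
  | iUnion f _ ih =>
    choose C hC hCc h using ih
    exact ⟨⋃ n, C n, Set.iUnion_subset hC, Set.countable_iUnion hCc,
      @MeasurableSet.iUnion _ _ (MeasurableSpace.generateFrom _) _ _ fun n =>
      MeasurableSpace.generateFrom_mono (Set.subset_iUnion C n) _ (h n)⟩

/-! ### Almost disjoint families and functionals -/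

/-- On the subsets of all but countably many members of an almost disjoint family a functional
is a Borel function. -/
theorem countable_not_measurable_betaIndicator_inter {ι : Type*} {A : ι → Set ℕ}
    (hA : ∀ i j, i ≠ j → (A i ∩ A j).Finite) (φ : C(BetaOmega, ℝ) →L[ℝ] ℝ) :
    {i | ¬ Measurable fun x : ℕ → Bool => φ (betaIndicator (codedSet x ∩ A i))}.Countable := by
  classical
  -- The bad indices carry a set with arbitrarily late tails of mass at least `1 / (m + 1)`. Too
  -- many of them would give, beyond all pairwise intersections, too many disjoint sets of large
  -- mass.
  let bad : ℕ → Set ι := fun m => {i | ∃ B ⊆ A i, ∀ J : ℕ, ∃ j ≥ J,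
    ((m : ℝ) + 1)⁻¹ ≤ |φ (betaIndicator (B \ Set.Iio j))|}
  have hfin : ∀ m, (bad m).Finite := by
    intro m
    by_contra hinf
    obtain ⟨M, hM⟩ := exists_nat_gt (‖φ‖ * (m + 1))
    obtain ⟨T, hT, hTM⟩ := Set.Infinite.exists_subset_card_eq hinf M
    obtain ⟨J, hJ⟩ : ∃ J : ℕ, ∀ i ∈ T, ∀ j ∈ T, i ≠ j → A i ∩ A j ⊆ Set.Iio J := by
      have hU : (⋃ i ∈ T, ⋃ j ∈ T, if i = j then (∅ : Set ℕ) else A i ∩ A j).Finite := by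
        refine T.finite_toSet.biUnion fun i _ => T.finite_toSet.biUnion fun j _ => ?_
        split_ifs with h
        · exact Set.finite_empty
        · exact hA i j h
      obtain ⟨J, hJ⟩ := hU.bddAbove
      refine ⟨J + 1, fun i hi j hj hij n hn => Nat.lt_succ_of_le (hJ ?_)⟩
      exact Set.mem_iUnion₂.2 ⟨i, hi, Set.mem_iUnion₂.2 ⟨j, hj, by rwa [if_neg hij]⟩⟩
    have hbad : ∀ i ∈ T, ∃ P ⊆ A i, Disjoint P (Set.Iio J) ∧
        ((m : ℝ) + 1)⁻¹ ≤ |φ (betaIndicator P)| := by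
      intro i hi
      obtain ⟨B, hB, hBJ⟩ := hT hi
      obtain ⟨j, hj, hjB⟩ := hBJ J
      exact ⟨_, Set.sdiff_subset.trans hB,
        Set.disjoint_sdiff_left.mono_right (Set.Iio_subset_Iio hj), hjB⟩
    choose! P hPA hPJ hPm using hbad
    have hle := card_mul_le_norm φ T P (fun i hi j hj hij => by
      refine Set.disjoint_left.2 fun n hni hnj => ?_
      exact Set.disjoint_left.1 (hPJ i hi) hni
        (hJ i hi j hj hij ⟨hPA i hi hni, hPA j hj hnj⟩)) hPm
    rw [hTM, ← div_eq_mul_inv, div_le_iff₀ (by positivity)] at hle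
    exact hle.not_gt hM
  refine (Set.countable_iUnion fun m => (hfin m).countable).mono fun i hi => ?_
  by_contra hgood
  simp only [Set.mem_iUnion, not_exists] at hgood
  -- At an index that is bad for no `m`, the function is the pointwise limit of its truncations,
  -- each depending on finitely many coordinates.
  refine hi (measurable_of_tendsto_metrizable
    (f := fun j x => φ (betaIndicator ((codedSet x ∩ A i) ∩ Set.Iio j))) (fun j => ?_) ?_)
  · refine measurable_of_finset_coordinates (Finset.range j) fun x y hxy => ?_
    have : (codedSet x ∩ A i) ∩ Set.Iio j = (codedSet y ∩ A i) ∩ Set.Iio j := by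
      ext n
      simp only [codedSet, Set.mem_inter_iff, Set.mem_ofPred_eq, Set.mem_Iio]
      refine and_congr_left fun hn => ?_
      rw [hxy n (Finset.mem_range.2 hn)]
    simp only [this]
  · refine tendsto_pi_nhds.2 fun x => Metric.tendsto_atTop.2 fun ε hε => ?_
    obtain ⟨m, hm⟩ := exists_nat_one_div_lt hε
    have hx := hgood m
    simp only [bad, Set.mem_ofPred_eq, not_exists, not_and, not_forall, not_le] at hx
    obtain ⟨J, hJ⟩ := hx (codedSet x ∩ A i) Set.inter_subset_right
    refine ⟨J, fun j hj => ?_⟩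
    rw [Real.dist_eq, betaIndicator_sdiff_add_inter (codedSet x ∩ A i) (Set.Iio j), map_add,
      abs_sub_comm, add_sub_cancel_right]
    exact (hJ j hj).trans ((one_div ((m : ℝ) + 1)) ▸ hm)

theorem isOpen_positiveSomewhere {ι : Type*} (F : ι → BetaOmega) :
    IsOpen[pointwiseTopology BetaOmega] (positiveSomewhere F) := by
  refine isOpen_induced_iff.2 ⟨⋃ i, (fun g : BetaOmega → ℝ => g (F i)) ⁻¹' Set.Ioi 0,
    isOpen_iUnion fun i => isOpen_Ioi.preimage (continuous_apply _), ?_⟩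
  ext f
  simp [positiveSomewhere]

theorem not_measurableSet_positiveSomewhere {ι : Type*} [Uncountable ι] {A : ι → Set ℕ}
    {F : ι → BetaOmega} (hA : IsAlmostDisjointFamily A) (hF : ∀ i, F i ∈ omegaStar)
    (hAF : ∀ i, A i ∈ F i) :
    ¬ MeasurableSet[baireSigmaAlgebra (weakTopology BetaOmega)] (positiveSomewhere F) := by
  classical
  intro hV
  obtain ⟨C, hC, hCc, hVC⟩ := exists_countable_measurableSet_generateFrom
    (MeasurableSpace.measurableSet_iSup.1 (baireSigmaAlgebra_weakTopology_le BetaOmega _ hV))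
  have hC' : ∀ s ∈ C, ∃ φ : C(BetaOmega, ℝ) →L[ℝ] ℝ,
      MeasurableSet[MeasurableSpace.comap φ (borel ℝ)] s := fun s hs => hC hs
  choose! φ hφ using hC'
  obtain ⟨i, hi⟩ : ∃ i, i ∉ ⋃ s ∈ C,
      {i | ¬ Measurable fun x : ℕ → Bool => φ s (betaIndicator (codedSet x ∩ A i))} := by
    by_contra! h
    refine Set.not_countable_univ (α := ι) ((hCc.biUnion fun s _ =>
      countable_not_measurable_betaIndicator_inter hA.2 (φ s)).mono fun i _ => h i)
  simp only [Set.mem_iUnion, Set.mem_ofPred_eq, not_exists, not_not] at hi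
  have hmeas : MeasurableSet
      ((fun x : ℕ → Bool => betaIndicator (codedSet x ∩ A i)) ⁻¹' positiveSomewhere F) := by
    refine @measurable_generateFrom _ _ _ C _ (fun s hs => ?_) _ hVC
    obtain ⟨U, hU, hUs⟩ := hφ s hs
    rw [← hUs]
    refine hi _ hs ?_
    rwa [BorelSpace.measurable_eq (α := ℝ)]
  -- Only `F i` matters: another `F j` containing a subset of `A i` would contain the finite set `A
  -- i ∩ A j`.
  have hset : (fun x : ℕ → Bool => betaIndicator (codedSet x ∩ A i)) ⁻¹' positiveSomewhere F =
      {x | codedSet x ∩ A i ∈ F i} := by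
    ext x
    simp only [positiveSomewhere, Set.mem_preimage, Set.mem_ofPred_eq, betaIndicator_apply]
    refine ⟨fun ⟨j, hj⟩ => ?_, fun h => ⟨i, by simp [h]⟩⟩
    have hj' : codedSet x ∩ A i ∈ F j := by
      by_contra h
      simp [h] at hj
    by_cases hij : i = j
    · rwa [hij] at hj' ⊢
    · refine absurd (Filter.mem_of_superset ((F j).inter_mem hj' (hAF j)) ?_)
        (notMem_of_finite_of_mem_omegaStar (hF j) (hA.2 i j hij))
      exact fun n hn => ⟨hn.1.2, hn.2⟩
  rw [hset] at hmeas
  have := eq_zero_of_measurable_of_additive (fun B => betaIndicator B (F i))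
    (fun B C hBC => by rw [betaIndicator_union hBC]; rfl)
    (fun B hB => by
      rw [betaIndicator_apply, if_neg (notMem_of_finite_of_mem_omegaStar (hF i) hB)]) (A i)
    (by
      simp only [betaIndicator_apply]
      exact Measurable.ite hmeas measurable_const measurable_const)
  rw [betaIndicator_apply, if_pos (hAF i)] at this
  exact one_ne_zero this

theorem exists_mem_omegaStar {A : Set ℕ} (hA : A.Infinite) : ∃ F ∈ omegaStar, A ∈ F := by
  have := hA.cofinite_inf_principal_neBot
  have hle : (Ultrafilter.of (Filter.cofinite ⊓ Filter.principal A) : Filter ℕ) ≤ _ :=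
    Ultrafilter.of_le _
  refine ⟨Ultrafilter.of (Filter.cofinite ⊓ Filter.principal A), ?_,
    hle (Filter.mem_inf_of_right (Filter.mem_principal_self A))⟩
  rintro ⟨n, hn⟩
  have hmem : ({n}ᶜ : Set ℕ) ∈ (pure n : Ultrafilter ℕ) := by
    rw [hn]
    exact hle (Filter.mem_inf_of_left (Set.finite_singleton n).compl_mem_cofinite)
  exact (Ultrafilter.mem_pure.1 hmem) rfl

/-- The branches of the binary tree form an almost disjoint family. -/
theorem isAlmostDisjointFamily_branches :
    IsAlmostDisjointFamily fun x : ℕ → Bool =>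
      Set.range fun n => Encodable.encode ((List.range n).map x) := by
  refine ⟨fun x => Set.infinite_range_of_injective fun m n h => ?_, fun x y hxy => ?_⟩
  · simpa using congrArg List.length (Encodable.encode_injective h)
  · obtain ⟨k, hk⟩ := Function.ne_iff.1 hxy
    refine ((Finset.range (k + 1)).finite_toSet.image
      fun n => Encodable.encode ((List.range n).map x)).subset ?_
    rintro _ ⟨⟨n, rfl⟩, ⟨m, hm⟩⟩
    refine ⟨n, ?_, rfl⟩
    have hl := Encodable.encode_injective hm
    have hmn : m = n := by simpa using congrArg List.length hl
    subst hmn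
    by_contra hkm
    simp only [Finset.coe_range, Set.mem_Iio, not_lt] at hkm
    exact hk ((List.map_inj_left.1 hl k (List.mem_range.2 hkm)).symm)

theorem not_borel_pointwise_le_baire_weak :
    ¬ borelSigmaAlgebra (pointwiseTopology BetaOmega) ≤
        baireSigmaAlgebra (weakTopology BetaOmega) := by
  intro h
  have hA := isAlmostDisjointFamily_branches
  choose F hF hAF using fun x => exists_mem_omegaStar (hA.1 x)
  have : Uncountable (ℕ → Bool) := Cardinal.aleph0_lt_mk_iff.1 (by
    simpa using Cardinal.cantor Cardinal.aleph0)
  exact not_measurableSet_positiveSomewhere hA hF hAF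
    (h _ (MeasurableSpace.measurableSet_generateFrom (isOpen_positiveSomewhere F)))

theorem exists_countable_measurable_generateFrom {α : Type*} {G : Set (Set α)} {f : α → ℝ}
    (hf : Measurable[MeasurableSpace.generateFrom G] f) :
    ∃ C ⊆ G, C.Countable ∧ Measurable[MeasurableSpace.generateFrom C] f := by
  choose C hC hCc hCm using fun q : ℚ =>
    exists_countable_measurableSet_generateFrom (hf (measurableSet_Iio (a := (q : ℝ))))
  refine ⟨⋃ q, C q, Set.iUnion_subset hC, Set.countable_iUnion hCc, ?_⟩
  rw [BorelSpace.measurable_eq (α := ℝ), Real.borel_eq_generateFrom_Iio_rat]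
  refine @measurable_generateFrom _ _ (MeasurableSpace.generateFrom _) _ _ fun s hs => ?_
  obtain ⟨q, rfl⟩ := Set.mem_iUnion.1 hs
  exact MeasurableSpace.generateFrom_mono (Set.subset_iUnion C q) _ (hCm q)

/-! ### Sets of small density and averages -/

open Classical in
/-- The number of elements of `E` below `k`. -/
noncomputable def countBelow (E : Set ℕ) (k : ℕ) : ℕ :=
  ((Finset.range k).filter (· ∈ E)).card

/-- `E` occupies at most the proportion `ε` of every initial segment of `ℕ`. -/
def DensityLE (E : Set ℕ) (ε : ℝ) : Prop :=
  ∀ k, (countBelow E k : ℝ) ≤ ε * k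

theorem countBelow_mono {E E' : Set ℕ} (h : E ⊆ E') (k : ℕ) : countBelow E k ≤ countBelow E' k := by
  classical
  exact Finset.card_le_card (Finset.monotone_filter_right _ fun _ _ hn => h hn)

theorem DensityLE.mono {E E' : Set ℕ} {ε : ℝ} (hE' : DensityLE E' ε) (h : E ⊆ E') :
    DensityLE E ε := fun k =>
  (Nat.cast_le.2 (countBelow_mono h k)).trans (hE' k)

theorem countBelow_iUnion_le (E : ℕ → Set ℕ) (k : ℕ) :
    ∃ I : Finset ℕ, countBelow (⋃ i, E i) k ≤ ∑ i ∈ I, countBelow (E i) k := by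
  classical
  have hex : ∀ n : ℕ, n ∈ ⋃ i, E i → ∃ i, n ∈ E i := fun n hn => Set.mem_iUnion.1 hn
  choose! g hg using hex
  refine ⟨((Finset.range k).filter (· ∈ ⋃ i, E i)).image g,
    (Finset.card_le_card fun n hn => ?_).trans Finset.card_biUnion_le⟩
  have hn' := Finset.mem_filter.1 hn
  exact Finset.mem_biUnion.2 ⟨g n, Finset.mem_image_of_mem g hn,
    Finset.mem_filter.2 ⟨hn'.1, hg n hn'.2⟩⟩

/-- The bounds add up to one half, and below each `k` finitely many of the sets already cover the
union. -/
theorem DensityLE.iUnion {E : ℕ → Set ℕ} (hE : ∀ i, DensityLE (E i) ((1 / 2) ^ i / 4)) :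
    DensityLE (⋃ i, E i) (1 / 2) := by
  intro k
  obtain ⟨I, hI⟩ := countBelow_iUnion_le E k
  have hsum : ∑ i ∈ I, ((1 : ℝ) / 2) ^ i / 4 ≤ 1 / 2 := by
    have := (summable_geometric_two.div_const 4).sum_le_tsum I fun i _ => by positivity
    rw [tsum_div_const, tsum_geometric_two] at this
    linarith
  calc (countBelow (⋃ i, E i) k : ℝ) ≤ ∑ i ∈ I, (countBelow (E i) k : ℝ) := by exact_mod_cast hI
    _ ≤ ∑ i ∈ I, ((1 : ℝ) / 2) ^ i / 4 * k := Finset.sum_le_sum fun i _ => hE i k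
    _ ≤ 1 / 2 * k := by
      rw [← Finset.sum_mul]
      exact mul_le_mul_of_nonneg_right hsum (Nat.cast_nonneg k)

theorem DensityLE.union {E E' : Set ℕ} {ε ε' : ℝ} (hE : DensityLE E ε) (hE' : DensityLE E' ε') :
    DensityLE (E ∪ E') (ε + ε') := by
  classical
  intro k
  have : countBelow (E ∪ E') k ≤ countBelow E k + countBelow E' k := by
    simp only [countBelow, Set.mem_union, Finset.filter_or]
    exact Finset.card_union_le _ _
  calc (countBelow (E ∪ E') k : ℝ) ≤ countBelow E k + countBelow E' k := by exact_mod_cast this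
    _ ≤ (ε + ε') * k := by rw [add_mul]; exact add_le_add (hE k) (hE' k)

/-- The ultrafilter contains a residue class modulo `M + 1`. Discarding the numbers below `M + 1`
makes the density bound hold at every `k`, not only in the limit. -/
theorem exists_mem_densityLE {F : BetaOmega} (hF : F ∈ omegaStar) {ε : ℝ} (hε : 0 < ε) :
    ∃ E ∈ F, DensityLE E ε := by
  classical
  obtain ⟨M, hM⟩ := exists_nat_one_div_lt hε
  have hcover : (⋃ r ∈ Set.Iio (M + 1), {j : ℕ | j % (M + 1) = r}) ∈ F :=
    Filter.mem_of_superset Filter.univ_mem fun j _ =>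
      Set.mem_biUnion (Set.mem_Iio.2 (Nat.mod_lt j M.succ_pos)) rfl
  obtain ⟨r, -, hr⟩ := (Ultrafilter.finite_biUnion_mem_iff (Set.finite_Iio (M + 1))).1 hcover
  have hlarge : (Set.Iio (M + 1))ᶜ ∈ F := Ultrafilter.compl_mem_iff_notMem.2
    (notMem_of_finite_of_mem_omegaStar hF (Set.finite_Iio (M + 1)))
  refine ⟨_, F.inter_mem hr hlarge, fun k => ?_⟩
  have hcard : countBelow ({j : ℕ | j % (M + 1) = r} ∩ (Set.Iio (M + 1))ᶜ) k ≤ k / (M + 1) := by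
    rw [← Nat.card_Ioc 0 (k / (M + 1)) |>.trans (Nat.sub_zero _)]
    refine Finset.card_le_card_of_injOn (· / (M + 1)) (fun j hj => ?_) fun i hi j hj hij => ?_
    · simp only [Finset.coe_filter, Finset.mem_range, Set.mem_inter_iff, Set.mem_ofPred_eq,
        Set.mem_compl_iff, Set.mem_Iio, not_lt] at hj
      simp only [Finset.coe_Ioc, Set.mem_Ioc]
      exact ⟨Nat.div_pos hj.2.2 M.succ_pos, Nat.div_le_div_right hj.1.le⟩
    · simp only [Finset.coe_filter, Finset.mem_range, Set.mem_inter_iff, Set.mem_ofPred_eq] at hi hj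
      rw [← Nat.div_add_mod i (M + 1), ← Nat.div_add_mod j (M + 1), hi.2.1, hj.2.1]
      simp only at hij
      rw [hij]
  calc (countBelow _ k : ℝ) ≤ ((k / (M + 1) : ℕ) : ℝ) := by exact_mod_cast hcard
    _ ≤ (k : ℝ) / ((M + 1 : ℕ) : ℝ) := Nat.cast_div_le
    _ = 1 / ((M : ℝ) + 1) * k := by push_cast; ring
    _ ≤ ε * k := mul_le_mul_of_nonneg_right hM.le (Nat.cast_nonneg k)

theorem exists_densityLE_forall_mem (T : Finset BetaOmega) {ε : ℝ} (hε : 0 < ε) :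
    ∃ E, DensityLE E ε ∧ ∀ F ∈ T, F ∈ omegaStar → E ∈ F := by
  classical
  induction T using Finset.induction_on generalizing ε with
  | empty => exact ⟨∅, fun k => by simp [countBelow]; positivity, by simp⟩
  | insert F T _ ih =>
    obtain ⟨E, hE, hET⟩ := ih (half_pos hε)
    by_cases hF : F ∈ omegaStar
    · obtain ⟨E', hE'F, hE'⟩ := exists_mem_densityLE hF (half_pos hε)
      refine ⟨E ∪ E', by simpa using hE.union hE', fun G hG hGs => ?_⟩
      rcases Finset.mem_insert.1 hG with rfl | hG
      · exact Filter.mem_of_superset hE'F Set.subset_union_right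
      · exact Filter.mem_of_superset (hET G hG hGs) Set.subset_union_left
    · refine ⟨E, fun k => (hE k).trans (by gcongr; linarith), fun G hG hGs => ?_⟩
      rcases Finset.mem_insert.1 hG with rfl | hG
      · exact absurd hGs hF
      · exact hET G hG hGs

/-- A functional on `C(βω)` that extends the asymptotic density. -/
theorem exists_density_functional : ∃ Λ : C(BetaOmega, ℝ) →L[ℝ] ℝ,
    (∀ B : Set ℕ, B.Finite → Λ (betaIndicator B) = 0) ∧ Λ (betaIndicator Set.univ) = 1 ∧
    ∀ E ε, DensityLE E ε → Λ (betaIndicator E) ≤ ε := by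
  classical
  let L : ℕ → C(BetaOmega, ℝ) →L[ℝ] ℝ := fun k =>
    (k : ℝ)⁻¹ • ∑ j ∈ Finset.range k, ContinuousMap.evalCLM ℝ (pure j : BetaOmega)
  have hLf : ∀ k f, L k f = (k : ℝ)⁻¹ * ∑ j ∈ Finset.range k, f (pure j : BetaOmega) := by
    intro k f
    simp [L]
  have hL : ∀ k, ‖L k‖ ≤ 1 := by
    intro k
    refine ContinuousLinearMap.opNorm_le_bound _ zero_le_one fun f => ?_
    rw [hLf, norm_mul, norm_inv, RCLike.norm_natCast, one_mul]
    have : ‖∑ j ∈ Finset.range k, f (pure j : BetaOmega)‖ ≤ k * ‖f‖ := by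
      refine (norm_sum_le_of_le _ fun j _ => f.norm_coe_le_norm _).trans ?_
      simp
    rcases k.eq_zero_or_pos with rfl | hk
    · simp
    · rw [inv_mul_le_iff₀ (by exact_mod_cast hk)]
      exact this
  have hLE : ∀ k E, L k (betaIndicator E) = (countBelow E k : ℝ) / k := by
    intro k E
    rw [hLf, div_eq_inv_mul]
    congr 1
    simp [betaIndicator_apply, countBelow, Ultrafilter.mem_pure]
  let U : Ultrafilter ℕ := Filter.hyperfilter ℕ
  -- By Banach–Alaoglu the averages over initial segments converge weak-* along a nonprincipal
  -- ultrafilter.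
  obtain ⟨Λ, -, hΛ⟩ := (WeakDual.isCompact_closedBall (0 : C(BetaOmega, ℝ) →L[ℝ] ℝ)
    1).ultrafilter_le_nhds (U.map fun k => StrongDual.toWeakDual (L k)) (by
      rw [Filter.le_principal_iff, Ultrafilter.mem_coe, Ultrafilter.mem_map]
      exact Filter.univ_mem' fun k => by simpa using hL k)
  have hlim : ∀ f, Filter.Tendsto (fun k => L k f) U (𝓝 (Λ f)) := fun f =>
    ((WeakDual.eval_continuous f).tendsto Λ).comp hΛ
  have hU : (U : Filter ℕ) ≤ Filter.atTop := by
    rw [← Nat.cofinite_eq_atTop]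
    exact Filter.hyperfilter_le_cofinite
  refine ⟨WeakDual.toStrongDual Λ, fun B hB => ?_, ?_, fun E ε hE => ?_⟩
  · refine tendsto_nhds_unique (hlim (betaIndicator B)) ?_
    have h0 : Filter.Tendsto (fun k : ℕ => (hB.toFinset.card : ℝ) / k) U (𝓝 0) :=
      (tendsto_const_div_atTop_nhds_zero_nat _).mono_left hU
    refine squeeze_zero (fun k => ?_) (fun k => ?_) h0
    · rw [hLE]; positivity
    · rw [hLE]
      gcongr
      exact Finset.card_le_card fun n hn => by simpa using (Finset.mem_filter.1 hn).2
  · refine tendsto_nhds_unique (hlim (betaIndicator Set.univ)) ?_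
    refine tendsto_const_nhds.congr' ?_
    filter_upwards [hU (Filter.eventually_gt_atTop 0)] with k hk
    have hk' : (k : ℝ) ≠ 0 := Nat.cast_ne_zero.2 (Nat.pos_iff_ne_zero.1 hk)
    rw [hLE]
    simp [countBelow, hk']
  · refine le_of_tendsto (hlim (betaIndicator E)) ?_
    filter_upwards [hU (Filter.eventually_gt_atTop 0)] with k hk
    have hk' : (0 : ℝ) < k := by exact_mod_cast hk
    rw [hLE, div_le_iff₀ hk']
    exact hE k

/-! ### Pointwise Borel sets on large sets of indicators -/

/-- All sets that differ from `A` outside of `D` and of a set of small density belong to `U`. -/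
def DensityInterior (U : Set C(BetaOmega, ℝ)) (A : Set ℕ) (D : Finset ℕ) : Prop :=
  ∀ ε > 0, ∃ E, DensityLE E ε ∧
    ∀ B, Disjoint (symmDiff A B) (↑D ∪ E) → betaIndicator B ∈ U

theorem mem_iff_of_disjoint_symmDiff {A B E : Set ℕ} (h : Disjoint (symmDiff A B) E)
    {n : ℕ} (hn : n ∈ E) : n ∈ A ↔ n ∈ B := by
  have := fun h' => Set.disjoint_left.1 h h' hn
  simp only [Set.mem_symmDiff, imp_false] at this
  tauto

/-- A basic neighbourhood looks at finitely many ultrafilters: the principal ones give `D`, and the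
nonprincipal ones share a sparse `E`. That `D` does not depend on `ε` lets countably many cases
suffice later. -/
theorem exists_densityInterior {U : Set C(BetaOmega, ℝ)}
    (hU : IsOpen[pointwiseTopology BetaOmega] U) {A : Set ℕ} (hA : betaIndicator A ∈ U) :
    ∃ D, DensityInterior U A D := by
  classical
  obtain ⟨W, hW, rfl⟩ := isOpen_induced_iff.1 hU
  obtain ⟨I, u, hu, hsub⟩ := isOpen_pi_iff.1 hW _ hA
  -- The value 0 at nonprincipal ultrafilters is harmless: it can only enlarge `D`.
  let g : BetaOmega → ℕ := fun F => if h : ∃ n, pure n = F then h.choose else 0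
  have hg : ∀ n : ℕ, (pure (g (pure n)) : BetaOmega) = pure n := fun n => by
    have h : ∃ m, (pure m : BetaOmega) = pure n := ⟨n, rfl⟩
    simp only [g, dif_pos h]
    exact h.choose_spec
  refine ⟨I.image g, fun ε hε => ?_⟩
  obtain ⟨E, hE, hEI⟩ := exists_densityLE_forall_mem I hε
  refine ⟨E, hE, fun B hB => hsub fun F hF => ?_⟩
  have hiff : B ∈ F ↔ A ∈ F := by
    by_cases hFs : F ∈ omegaStar
    · have hEF := hEI F hF hFs
      have hAB : A ∩ E = B ∩ E := by
        ext n
        simp only [Set.mem_inter_iff]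
        exact and_congr_left fun hn => mem_iff_of_disjoint_symmDiff hB (Or.inr hn)
      constructor
      · intro h
        exact Filter.mem_of_superset (hAB ▸ F.inter_mem h hEF) Set.inter_subset_left
      · intro h
        exact Filter.mem_of_superset (hAB.symm ▸ F.inter_mem h hEF) Set.inter_subset_left
    · obtain ⟨n, rfl⟩ := not_not.1 hFs
      rw [← hg n, Ultrafilter.mem_pure, Ultrafilter.mem_pure]
      exact (mem_iff_of_disjoint_symmDiff hB
        (Or.inl (Finset.mem_coe.2 (Finset.mem_image_of_mem g hF)))).symm
  have : betaIndicator B F = betaIndicator A F := by simp only [betaIndicator_apply, hiff]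
  change betaIndicator B F ∈ u F
  rw [this]
  exact (hu F hF).2

/-- The limit of a decreasing sequence of conditions. -/
theorem exists_forall_symmDiff_subset {A N : ℕ → Set ℕ} (hN : ∀ i, N (i + 1) ⊆ N i)
    (hA : ∀ i, symmDiff (A i) (A (i + 1)) ⊆ N i) :
    ∃ A', ∀ i, symmDiff (A i) A' ⊆ N i := by
  have hmono : ∀ i j, i ≤ j → N j ⊆ N i ∧ symmDiff (A i) (A j) ⊆ N i := by
    intro i j hij
    induction j, hij using Nat.le_induction with
    | base => simp
    | succ j _ ih =>
      exact ⟨(hN j).trans ih.1, (symmDiff_triangle (A i) (A j) (A (j + 1))).trans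
        (sup_le ih.2 ((hA j).trans ih.1))⟩
  -- Membership of `n` is settled once `n` leaves some `N i`; points that never leave are omitted.
  refine ⟨{n | ∃ i, n ∉ N i ∧ n ∈ A i}, fun i n hn => ?_⟩
  by_contra hni
  have key : ∀ j, n ∉ N j → (n ∈ A j ↔ n ∈ A i) := by
    intro j hnj
    rcases le_total i j with h | h
    · have := fun h' => hni ((hmono i j h).2 h')
      simp only [Set.mem_symmDiff, imp_false] at this
      tauto
    · have := fun h' => hnj ((hmono j i h).2 h')
      simp only [Set.mem_symmDiff, imp_false] at this
      tauto
  rcases hn with ⟨h1, h2⟩ | ⟨⟨j, hj, hjA⟩, h2⟩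
  · exact h2 ⟨i, hni, h1⟩
  · exact h2 ((key j hj).1 hjA)

/-- If some admissible `B` has the interior property, move to it and freeze the sparse set `E \ D`:
every later set with trace `τ` on `D` then agrees with `B` on `D ∪ E`. Otherwise the last clause is
vacuous. -/
theorem exists_refine_densityInterior (U : Set C(BetaOmega, ℝ)) (D τ : Finset ℕ) {ε : ℝ}
    (hε : 0 < ε) (p : Set ℕ × Set ℕ) : ∃ q : Set ℕ × Set ℕ, q.2 ⊆ p.2 ∧ symmDiff p.1 q.1 ⊆ p.2 ∧
      DensityLE (p.2 \ q.2) ε ∧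
      ∀ B, symmDiff q.1 B ⊆ q.2 → B ∩ D = τ → DensityInterior U B D →
        ∀ B', symmDiff q.1 B' ⊆ q.2 → B' ∩ D = τ → betaIndicator B' ∈ U := by
  obtain ⟨A, N⟩ := p
  by_cases h : ∃ B, symmDiff A B ⊆ N ∧ B ∩ D = τ ∧ DensityInterior U B D
  · obtain ⟨B, hBN, hBτ, hBU⟩ := h
    obtain ⟨E, hE, hEU⟩ := hBU ε hε
    refine ⟨(B, N \ (E \ D)), Set.sdiff_subset, hBN, hE.mono ?_, ?_⟩
    · rintro n ⟨hn, hn'⟩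
      by_contra hnE
      exact hn' ⟨hn, fun h => hnE h.1⟩
    · intro _ _ _ _ B' hB' hB'τ
      refine hEU B' (Set.disjoint_left.2 fun n hn hnDE => ?_)
      have hnD : n ∉ (D : Set ℕ) := fun hnD => by
        have : n ∈ B ∩ D ↔ n ∈ B' ∩ D := by rw [hBτ, hB'τ]
        simp only [Set.mem_inter_iff, hnD, and_true] at this
        rw [Set.mem_symmDiff] at hn
        tauto
      exact (hB' hn).2 ⟨hnDE.resolve_left hnD, hnD⟩
  · refine ⟨(A, N), subset_rfl, by simp, fun k => ?_, fun B hB hBτ hBU => ?_⟩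
    · simp [countBelow]; positivity
    · exact absurd ⟨B, hB, hBτ, hBU⟩ h

/-- The set that agrees with `A` outside of `N` and with the set coded by `x` on `N`. -/
def graft (A N : Set ℕ) (x : ℕ → Bool) : Set ℕ :=
  (A \ N) ∪ (codedSet x ∩ N)

theorem symmDiff_graft_subset (A N : Set ℕ) (x : ℕ → Bool) : symmDiff A (graft A N x) ⊆ N := by
  intro n hn
  by_contra h
  simp [graft, Set.mem_symmDiff, h] at hn

theorem betaIndicator_graft (A N : Set ℕ) (x : ℕ → Bool) :
    betaIndicator (graft A N x) = betaIndicator (A \ N) + betaIndicator (codedSet x ∩ N) :=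
  betaIndicator_union (Set.disjoint_sdiff_left.mono_right Set.inter_subset_right)

theorem mem_graft_congr (A N : Set ℕ) {x y : ℕ → Bool} {n : ℕ} (h : x n = y n) :
    n ∈ graft A N x ↔ n ∈ graft A N y := by
  simp [graft, codedSet, h]

theorem measurableSet_graft_inter_eq (A N : Set ℕ) (D τ : Finset ℕ) :
    MeasurableSet {x | graft A N x ∩ D = τ} := by
  refine measurableSet_setOfPred.2 (measurable_of_finset_coordinates D fun x y hxy => ?_)
  have : graft A N x ∩ D = graft A N y ∩ D := by
    ext n
    simp only [Set.mem_inter_iff, Finset.mem_coe]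
    exact and_congr_left fun hn => mem_graft_congr A N (hxy n hn)
  rw [this]

/-- Countably many pointwise open sets are simultaneously Borel on the sets that differ from some
`A` within a set `N` of large density. -/
theorem exists_graft_measurableSet_of_pointwise (U : ℕ → Set C(BetaOmega, ℝ))
    (hU : ∀ n, IsOpen[pointwiseTopology BetaOmega] (U n)) :
    ∃ A N : Set ℕ, DensityLE Nᶜ (1 / 2) ∧
      ∀ n, MeasurableSet ((fun x => betaIndicator (graft A N x)) ⁻¹' U n) := by
  classical
  -- Every triple of an open set, a finite window and a trace on it is treated at some stage; the
  -- frozen sets have total density at most one half.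
  obtain ⟨c, hc⟩ := exists_surjective_nat (ℕ × Finset ℕ × Finset ℕ)
  have hpos : ∀ i : ℕ, (0 : ℝ) < (1 / 2) ^ i / 4 := fun i => by positivity
  choose step hs1 hs2 hs3 hs4 using fun i => exists_refine_densityInterior (U (c i).1)
    (c i).2.1 (c i).2.2 (hpos i)
  let s : ℕ → Set ℕ × Set ℕ := fun i => Nat.rec (∅, Set.univ) (fun i p => step i p) i
  have hs : ∀ i, s (i + 1) = step i (s i) := fun i => rfl
  obtain ⟨A, hA⟩ := exists_forall_symmDiff_subset (A := fun i => (s i).1) (N := fun i => (s i).2)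
    (fun i => hs1 i (s i)) (fun i => hs2 i (s i))
  let N : Set ℕ := ⋂ i, (s i).2
  have hB : ∀ B, symmDiff A B ⊆ N → ∀ i, symmDiff (s i).1 B ⊆ (s i).2 := fun B hB i =>
    (symmDiff_triangle _ A B).trans (sup_le (hA i) (hB.trans (Set.iInter_subset _ i)))
  refine ⟨A, N, ?_, fun n => ?_⟩
  · refine (DensityLE.iUnion fun i => hs3 i (s i)).mono fun n hn => ?_
    by_contra hcon
    simp only [Set.mem_iUnion, not_exists] at hcon
    refine hn (Set.mem_iInter.2 fun i => ?_)
    induction i with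
    | zero => trivial
    | succ i ih =>
      by_contra h
      exact hcon i ⟨ih, h⟩
  · let G : Set (Finset ℕ × Finset ℕ) := {d | ∃ x, graft A N x ∩ d.1 = d.2 ∧
      DensityInterior (U n) (graft A N x) d.1}
    have heq : (fun x => betaIndicator (graft A N x)) ⁻¹' U n =
        ⋃ d ∈ G, {x | graft A N x ∩ d.1 = d.2} := by
      ext x
      simp only [Set.mem_preimage, Set.mem_iUnion, Set.mem_ofPred_eq, exists_prop]
      constructor
      · intro hx
        obtain ⟨D, hD⟩ := exists_densityInterior (hU n) hx
        have hτ : graft A N x ∩ D = ↑(D.filter (· ∈ graft A N x)) := by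
          ext k
          simp [and_comm]
        exact ⟨(D, D.filter (· ∈ graft A N x)), ⟨x, hτ, hD⟩, hτ⟩
      · rintro ⟨⟨D, τ⟩, ⟨y, hyτ, hyD⟩, hxτ⟩
        obtain ⟨i, hi⟩ := hc (n, D, τ)
        have key := hs4 i (s i)
        rw [hi, ← hs] at key
        exact key _ (hB _ (symmDiff_graft_subset A N y) (i + 1)) hyτ hyD _
          (hB _ (symmDiff_graft_subset A N x) (i + 1)) hxτ
    rw [heq]
    exact MeasurableSet.biUnion (Set.to_countable G) fun d _ =>
      measurableSet_graft_inter_eq A N d.1 d.2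

theorem exists_seq_of_countable_isOpen {X : Type*} (t : TopologicalSpace X) {C : Set (Set X)}
    (hC : C ⊆ {s | IsOpen[t] s}) (hCc : C.Countable) :
    ∃ U : ℕ → Set X, (∀ n, IsOpen[t] (U n)) ∧ C ⊆ Set.range U := by
  obtain ⟨U, hU⟩ := (hCc.insert Set.univ).exists_eq_range (Set.insert_nonempty _ _)
  refine ⟨U, fun n => ?_, fun s hs => hU ▸ Set.mem_insert_of_mem _ hs⟩
  have hn : U n ∈ insert Set.univ C := hU ▸ Set.mem_range_self n
  rcases hn with h | h
  · rw [h]; exact isOpen_univ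
  · exact hC h

/-- Some functional is not Borel for the topology of pointwise convergence. -/
theorem exists_not_measurable_borel_pointwise : ∃ Λ : C(BetaOmega, ℝ) →L[ℝ] ℝ,
    ¬ Measurable[borelSigmaAlgebra (pointwiseTopology BetaOmega)] Λ := by
  obtain ⟨Λ, hfin, huniv, hdens⟩ := exists_density_functional
  refine ⟨Λ, fun hΛ => ?_⟩
  obtain ⟨C, hC, hCc, hΛC⟩ := exists_countable_measurable_generateFrom hΛ
  obtain ⟨U, hU, hCU⟩ := exists_seq_of_countable_isOpen _ hC hCc
  obtain ⟨A, N, hN, hmeas⟩ := exists_graft_measurableSet_of_pointwise U hU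
  have hgraft : Measurable[_, MeasurableSpace.generateFrom C]
      fun x => betaIndicator (graft A N x) := by
    refine @measurable_generateFrom _ _ _ C _ fun s hs => ?_
    obtain ⟨n, rfl⟩ := hCU hs
    exact hmeas n
  have hadd : ∀ B B' : Set ℕ, Disjoint B B' →
      Λ (betaIndicator (B ∪ B')) = Λ (betaIndicator B) + Λ (betaIndicator B') := fun B B' h => by
    rw [betaIndicator_union h, map_add]
  have hcomp : Measurable fun x => Λ (betaIndicator (graft A N x)) :=
    @Measurable.comp _ _ _ _ (MeasurableSpace.generateFrom C) _ _ _ hΛC hgraft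
  -- Hence `Λ` vanishes at `N`, so `Nᶜ` carries the total value 1 in spite of its density bound 1/2.
  have h0 := eq_zero_of_measurable_of_additive (fun B => Λ (betaIndicator B)) hadd hfin N (by
    simp only [betaIndicator_graft, map_add] at hcomp
    simpa using hcomp.sub_const (Λ (betaIndicator (A \ N))))
  have h1 := hadd N Nᶜ disjoint_compl_right
  rw [Set.union_compl_self, huniv, h0] at h1
  have h2 := hdens _ _ hN
  linarith

/-! ### Weakly Borel sets on infinite sets of indicators -/

/-- Otherwise the rows of a pairing function split an infinite part of `N` into infinitely many
disjoint infinite sets, each with a subset of mass at least `ε`, against the boundedness of `φ`. -/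
theorem exists_infinite_subset_forall_abs_lt (φ : C(BetaOmega, ℝ) →L[ℝ] ℝ) {N : Set ℕ}
    (hN : N.Infinite) {ε : ℝ} (hε : 0 < ε) :
    ∃ C ⊆ N, C.Infinite ∧ ∀ P ⊆ C, |φ (betaIndicator P)| < ε := by
  by_contra! hcon
  let f := hN.natEmbedding N
  have hf : Function.Injective fun k => (f k : ℕ) := Subtype.val_injective.comp f.injective
  let C : ℕ → Set ℕ := fun i => Set.range fun j => (f (Nat.pair i j) : ℕ)
  have hC : ∀ i, ∃ P ⊆ C i, ε ≤ |φ (betaIndicator P)| := fun i =>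
    hcon (C i) (Set.range_subset_iff.2 fun j => (f _).2)
      (Set.infinite_range_of_injective fun j j' h => (Nat.pair_eq_pair.1 (hf h)).2)
  choose P hPC hP using hC
  obtain ⟨M, hM⟩ := exists_nat_gt (‖φ‖ / ε)
  have := card_mul_le_norm φ (Finset.range M) P (fun i _ j _ hij => by
    refine Set.disjoint_left.2 fun n hn hn' => ?_
    obtain ⟨k, rfl⟩ := hPC i hn
    obtain ⟨k', hk'⟩ := hPC j hn'
    exact hij (Nat.pair_eq_pair.1 (hf hk')).1.symm) fun i _ => hP i
  rw [Finset.card_range, ← le_div_iff₀ hε] at this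
  exact this.not_gt hM

theorem exists_infinite_subset_forall_mem_abs_lt (T : Finset (C(BetaOmega, ℝ) →L[ℝ] ℝ))
    {N : Set ℕ} (hN : N.Infinite) {ε : (C(BetaOmega, ℝ) →L[ℝ] ℝ) → ℝ} (hε : ∀ φ ∈ T, 0 < ε φ) :
    ∃ C ⊆ N, C.Infinite ∧ ∀ φ ∈ T, ∀ P ⊆ C, |φ (betaIndicator P)| < ε φ := by
  classical
  induction T using Finset.induction_on with
  | empty => exact ⟨N, subset_rfl, hN, by simp⟩
  | insert φ T _ ih =>
    obtain ⟨C, hCN, hC, hCT⟩ := ih fun ψ hψ => hε ψ (Finset.mem_insert_of_mem hψ)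
    obtain ⟨C', hC'C, hC', hφ⟩ :=
      exists_infinite_subset_forall_abs_lt φ hC (hε φ (Finset.mem_insert_self _ _))
    refine ⟨C', hC'C.trans hCN, hC', fun ψ hψ P hP => ?_⟩
    rcases Finset.mem_insert.1 hψ with rfl | hψ
    · exact hφ P hP
    · exact hCT ψ hψ P (hP.trans hC'C)

theorem exists_infinite_subset_betaIndicator_mem {U : Set C(BetaOmega, ℝ)}
    (hU : IsOpen[weakTopology BetaOmega] U) {A N : Set ℕ} (hN : N.Infinite)
    (hA : betaIndicator A ∈ U) :
    ∃ C ⊆ N, C.Infinite ∧ ∀ B, symmDiff A B ⊆ C → betaIndicator B ∈ U := by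
  obtain ⟨V, hV, rfl⟩ := isOpen_induced_iff.1 hU
  obtain ⟨W, hW, rfl⟩ := isOpen_induced_iff.1 hV
  obtain ⟨I, u, hu, hsub⟩ := isOpen_pi_iff.1 hW _ hA
  have hball : ∀ φ ∈ I, ∃ ε > 0, Metric.ball (φ (betaIndicator A)) ε ⊆ u φ := fun φ hφ =>
    Metric.isOpen_iff.1 (hu φ hφ).1 _ (hu φ hφ).2
  choose! ε hε hεu using hball
  obtain ⟨C, hCN, hC, hCI⟩ := exists_infinite_subset_forall_mem_abs_lt I hN
    (ε := fun φ => ε φ / 2) fun φ hφ => half_pos (hε φ hφ)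
  refine ⟨C, hCN, hC, fun B hB => hsub fun φ hφ => hεu φ hφ ?_⟩
  change dist (φ (betaIndicator B)) (φ (betaIndicator A)) < ε φ
  rw [betaIndicator_sdiff_add_inter A B, betaIndicator_sdiff_add_inter B A, Set.inter_comm B A,
    Real.dist_eq, map_add, map_add, add_sub_add_right_eq_sub]
  have h1 := hCI φ hφ (A \ B) ((Set.subset_union_left).trans hB)
  have h2 := hCI φ hφ (B \ A) ((Set.subset_union_right).trans hB)
  exact (abs_sub _ _).trans_lt (by linarith)

/-- Membership in `U` is constant on the sets that differ from `A` within `C`. -/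
def DecidedOn (U : Set C(BetaOmega, ℝ)) (A C : Set ℕ) : Prop :=
  ∀ B B', symmDiff A B ⊆ C → symmDiff A B' ⊆ C → betaIndicator B ∈ U → betaIndicator B' ∈ U

theorem DecidedOn.mono {U : Set C(BetaOmega, ℝ)} {A A' C C' : Set ℕ} (h : DecidedOn U A C)
    (hA : symmDiff A A' ⊆ C) (hC : C' ⊆ C) : DecidedOn U A' C' := fun B B' hB hB' =>
  h B B' ((symmDiff_triangle A A' B).trans (sup_le hA (hB.trans hC)))
    ((symmDiff_triangle A A' B').trans (sup_le hA (hB'.trans hC)))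

/-- Either an admissible set lies in `U`, and weak openness provides an infinite room for changes
inside `U`, or none does and the decision is negative. -/
theorem exists_decidedOn {U : Set C(BetaOmega, ℝ)} (hU : IsOpen[weakTopology BetaOmega] U)
    (A : Set ℕ) {N : Set ℕ} (hN : N.Infinite) :
    ∃ A' C, C ⊆ N ∧ C.Infinite ∧ symmDiff A A' ⊆ N ∧ DecidedOn U A' C := by
  by_cases h : ∃ B, symmDiff A B ⊆ N ∧ betaIndicator B ∈ U
  · obtain ⟨B, hBN, hB⟩ := h
    obtain ⟨C, hCN, hC, hCU⟩ := exists_infinite_subset_betaIndicator_mem hU hN hB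
    exact ⟨B, C, hCN, hC, hBN, fun _ B' _ hB' _ => hCU B' hB'⟩
  · push Not at h
    exact ⟨A, N, subset_rfl, hN, by simp, fun B _ hB _ hBU => absurd hBU (h B hB)⟩

theorem exists_forall_decidedOn_symmDiff {U : Set C(BetaOmega, ℝ)}
    (hU : IsOpen[weakTopology BetaOmega] U) (L : Finset (Finset ℕ)) (A : Set ℕ) {N : Set ℕ}
    (hN : N.Infinite) : ∃ A' C, C ⊆ N ∧ C.Infinite ∧ symmDiff A A' ⊆ N ∧
      ∀ τ ∈ L, DecidedOn U (symmDiff A' τ) C := by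
  induction L using Finset.induction_on with
  | empty => exact ⟨A, N, subset_rfl, hN, by simp, by simp⟩
  | insert τ L _ ih =>
    obtain ⟨A₁, C₁, hC₁N, hC₁, hA₁, hL⟩ := ih
    obtain ⟨A₂, C₂, hC₂, hC₂i, hA₂, hτ⟩ := exists_decidedOn hU (symmDiff A₁ τ) hC₁
    have hA₁₂ : symmDiff A₁ (symmDiff A₂ τ) ⊆ C₁ := by
      rwa [symmDiff_comm A₂, ← symmDiff_assoc]
    -- Decide the translate by `τ`, then translate back. Earlier decisions survive because the base
    -- set changed only within `C₁`.
    refine ⟨symmDiff A₂ τ, C₂, hC₂.trans hC₁N, hC₂i,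
      (symmDiff_triangle A A₁ _).trans (sup_le hA₁ (hA₁₂.trans hC₁N)), fun τ' hτ' => ?_⟩
    rcases Finset.mem_insert.1 hτ' with rfl | hτ'
    · rwa [symmDiff_symmDiff_cancel_right]
    · refine (hL τ' hτ').mono ?_ hC₂
      rwa [symmDiff_symmDiff_symmDiff_comm, symmDiff_self, symmDiff_bot]

/-- One step of the fusion: a new coordinate is kept, and membership in `U` becomes a function of
the kept coordinates. -/
theorem exists_fusion_step {U : Set C(BetaOmega, ℝ)} (hU : IsOpen[weakTopology BetaOmega] U)
    (p : Set ℕ × Finset ℕ × {M : Set ℕ // M.Infinite}) :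
    ∃ q : Set ℕ × Finset ℕ × {M : Set ℕ // M.Infinite}, p.2.1 ⊂ q.2.1 ∧
      (↑q.2.1 ∪ q.2.2.1 : Set ℕ) ⊆ ↑p.2.1 ∪ p.2.2.1 ∧ symmDiff p.1 q.1 ⊆ ↑p.2.1 ∪ p.2.2.1 ∧
      ∀ B B', symmDiff q.1 B ⊆ ↑q.2.1 ∪ q.2.2.1 → symmDiff q.1 B' ⊆ ↑q.2.1 ∪ q.2.2.1 →
        (∀ n ∈ q.2.1, n ∈ B ↔ n ∈ B') → betaIndicator B ∈ U → betaIndicator B' ∈ U := by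
  classical
  obtain ⟨A, K, M, hM⟩ := p
  obtain ⟨k, hkM, hkK⟩ := hM.exists_notMem_finset K
  obtain ⟨A', C, hCM, hC, hA', hdec⟩ := exists_forall_decidedOn_symmDiff hU
    (insert k K).powerset A (hM.sdiff (insert k K).finite_toSet)
  refine ⟨(A', insert k K, ⟨C, hC⟩), Finset.ssubset_insert hkK, ?_, ?_, ?_⟩
  · rintro n (hn | hn)
    · rcases Finset.mem_insert.1 (Finset.mem_coe.1 hn) with rfl | hn
      · exact Or.inr hkM
      · exact Or.inl hn
    · exact Or.inr (hCM hn).1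
  · exact fun n hn => Or.inr (hA' hn).1
  · intro B B' hB hB' hBB'
    -- With this trace, `A'` modified by it agrees with `B` and `B'` on the kept coordinates, hence
    -- differs from them only within `C`.
    refine hdec ((insert k K).filter (· ∈ symmDiff A' B)) (by simp) B B' ?_ ?_
    · intro n hn
      by_cases hnK : n ∈ insert k K
      · simp only [Set.mem_symmDiff, Finset.coe_filter, Set.mem_ofPred_eq, hnK] at hn
        tauto
      · refine (hB (?_ : n ∈ symmDiff A' B)).resolve_left hnK
        simp only [Set.mem_symmDiff, Finset.coe_filter, Set.mem_ofPred_eq, hnK] at hn ⊢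
        tauto
    · intro n hn
      by_cases hnK : n ∈ insert k K
      · have := hBB' n hnK
        simp only [Set.mem_symmDiff, Finset.coe_filter, Set.mem_ofPred_eq, hnK] at hn
        tauto
      · refine (hB' (?_ : n ∈ symmDiff A' B')).resolve_left hnK
        simp only [Set.mem_symmDiff, Finset.coe_filter, Set.mem_ofPred_eq, hnK] at hn ⊢
        tauto

/-- Countably many weakly open sets are simultaneously Borel on the sets that differ from some `A`
within an infinite set `N`. -/
theorem exists_graft_measurableSet_of_weak (U : ℕ → Set C(BetaOmega, ℝ))
    (hU : ∀ n, IsOpen[weakTopology BetaOmega] (U n)) :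
    ∃ A N : Set ℕ, N.Infinite ∧
      ∀ n, MeasurableSet ((fun x => betaIndicator (graft A N x)) ⁻¹' U n) := by
  choose step hs1 hs2 hs3 hs4 using fun i => exists_fusion_step (hU i)
  let s : ℕ → Set ℕ × Finset ℕ × {M : Set ℕ // M.Infinite} := fun i =>
    Nat.rec (∅, ∅, ⟨Set.univ, Set.infinite_univ⟩) (fun i p => step i p) i
  have hs : ∀ i, s (i + 1) = step i (s i) := fun i => rfl
  have hanti : Antitone fun i => (↑(s i).2.1 ∪ (s i).2.2.1 : Set ℕ) :=
    antitone_nat_of_succ_le fun i => hs2 i (s i)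
  have hmono : StrictMono fun i => (s i).2.1 := strictMono_nat_of_lt_succ fun i => hs1 i (s i)
  obtain ⟨A, hA⟩ := exists_forall_symmDiff_subset (A := fun i => (s i).1)
    (N := fun i => ↑(s i).2.1 ∪ (s i).2.2.1) (fun i => hs2 i (s i)) (fun i => hs3 i (s i))
  -- The kept coordinates form `N`; those kept by stage `n + 1` decide membership in `U n`.
  let N : Set ℕ := ⋃ i, ((s i).2.1 : Set ℕ)
  have hNs : ∀ i, N ⊆ ↑(s i).2.1 ∪ (s i).2.2.1 := by
    refine fun i => Set.iUnion_subset fun j => ?_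
    rcases le_total i j with h | h
    · exact Set.subset_union_left.trans (hanti h)
    · exact (Finset.coe_subset.2 (hmono.monotone h)).trans Set.subset_union_left
  have hB : ∀ x i, symmDiff (s i).1 (graft A N x) ⊆ ↑(s i).2.1 ∪ (s i).2.2.1 := fun x i =>
    (symmDiff_triangle _ A _).trans (sup_le (hA i) ((symmDiff_graft_subset A N x).trans (hNs i)))
  refine ⟨A, N, fun hfin => ?_, fun n => ?_⟩
  · have hsub : ∀ i, (s i).2.1 ⊆ hfin.toFinset := fun i k hk =>
      hfin.mem_toFinset.2 (Set.mem_iUnion.2 ⟨i, hk⟩)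
    have hcard : StrictMono fun i => (s i).2.1.card := fun i j hij =>
      Finset.card_lt_card (hmono hij)
    exact absurd (Finset.card_le_card (hsub (hfin.toFinset.card + 1)))
      (not_le.2 (hcard.le_apply (x := hfin.toFinset.card + 1)))
  · refine measurableSet_setOfPred.2
      (measurable_of_finset_coordinates (s (n + 1)).2.1 fun x y hxy => ?_)
    have hstep : ∀ x y : ℕ → Bool, (∀ i ∈ (s (n + 1)).2.1, x i = y i) →
        betaIndicator (graft A N x) ∈ U n → betaIndicator (graft A N y) ∈ U n := fun x y hxy =>
      hs4 n (s n) _ _ (hB x (n + 1)) (hB y (n + 1)) fun k hk => mem_graft_congr A N (hxy k hk)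
    exact propext ⟨hstep x y hxy, hstep y x fun i hi => (hxy i hi).symm⟩

/-! ### A norm closed set that is not weakly Borel -/

theorem even_ncard_symmDiff_singleton {X : Set ℕ} (hX : X.Finite) (n : ℕ) :
    Even (symmDiff X {n}).ncard ↔ ¬ Even X.ncard := by
  by_cases hn : n ∈ X
  · have h : symmDiff X {n} = X \ {n} := by
      ext k
      by_cases hk : k = n <;> simp [Set.mem_symmDiff, hk, hn]
    rw [h, ← Set.ncard_sdiff_singleton_add_one hn hX, Nat.even_add_one, not_not]
  · have h : symmDiff X {n} = insert n X := by
      ext k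
      by_cases hk : k = n <;> simp [Set.mem_symmDiff, hk, hn]
    rw [h, Set.ncard_insert_of_notMem hn hX, Nat.even_add_one]

/-- Choose a representative of each class modulo finite sets and take the parity of the finite
difference from it. -/
theorem exists_parity : ∃ p : Set ℕ → Prop, ∀ A n, p (symmDiff A {n}) ↔ ¬ p A := by
  let r : Setoid (Set ℕ) :=
    { r := fun A B => (symmDiff A B).Finite
      iseqv := ⟨fun A => by simp, fun h => by rwa [symmDiff_comm], fun h h' =>
        (h.union h').subset (symmDiff_triangle _ _ _)⟩ }
  refine ⟨fun A => Even (symmDiff A (Quotient.out (Quotient.mk r A))).ncard, fun A n => ?_⟩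
  have h : Quotient.mk r (symmDiff A {n}) = Quotient.mk r A := by
    refine Quotient.sound ?_
    change (symmDiff (symmDiff A {n}) A).Finite
    rw [symmDiff_comm, symmDiff_symmDiff_cancel_left]
    exact Set.finite_singleton n
  have hfin : (symmDiff A (Quotient.out (Quotient.mk r A))).Finite :=
    r.symm (Quotient.mk_out A)
  beta_reduce
  rw [h, symmDiff_right_comm, even_ncard_symmDiff_singleton hfin]

theorem one_le_dist_betaIndicator {A B : Set ℕ} (h : A ≠ B) :
    1 ≤ dist (betaIndicator A) (betaIndicator B) := by
  classical
  obtain ⟨n, hn⟩ : ∃ n, ¬ (n ∈ A ↔ n ∈ B) := by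
    by_contra! hcon
    exact h (Set.ext hcon)
  refine le_trans ?_ (ContinuousMap.dist_apply_le_dist (pure n : BetaOmega))
  simp only [betaIndicator_apply, Ultrafilter.mem_pure]
  by_cases hA : n ∈ A <;> by_cases hB : n ∈ B <;> simp [hA, hB] at hn ⊢

theorem betaIndicator_injective : Function.Injective betaIndicator := fun A B h => by
  by_contra hAB
  have := one_le_dist_betaIndicator hAB
  rw [h, dist_self] at this
  exact not_lt.2 this one_pos

/-- Changing one coordinate of `y` changes the grafted set by one point. -/
theorem graft_extend_update {A N : Set ℕ} {f : ℕ → ℕ} (hf : Function.Injective f)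
    (hfN : ∀ k, f k ∈ N) (y : ℕ → Bool) (k : ℕ) :
    graft A N (Function.extend f (Function.update y k (!y k)) fun _ => false) =
      symmDiff (graft A N (Function.extend f y fun _ => false)) {f k} := by
  ext n
  by_cases hn : ∃ j, f j = n
  · obtain ⟨j, rfl⟩ := hn
    have h := hfN j
    by_cases hj : j = k
    · subst hj
      simp [graft, codedSet, Set.mem_symmDiff, h, hf.extend_apply]
    · simp [graft, codedSet, Set.mem_symmDiff, h, hf.extend_apply, hj, hf.eq_iff]
  · have hk : n ≠ f k := fun h => hn ⟨k, h.symm⟩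
    simp [graft, codedSet, Set.mem_symmDiff, Function.extend_apply' _ _ _ hn, hk]

theorem measurable_extend_const {f : ℕ → ℕ} (hf : Function.Injective f) :
    Measurable fun y : ℕ → Bool => Function.extend f y fun _ => false := by
  refine measurable_pi_iff.2 fun n => ?_
  by_cases hn : ∃ j, f j = n
  · obtain ⟨j, rfl⟩ := hn
    simp only [hf.extend_apply]
    exact measurable_pi_apply j
  · simp only [Function.extend_apply' _ _ _ hn]
    exact measurable_const

theorem not_borel_norm_le_borel_weak :
    ¬ borelSigmaAlgebra (normTopology BetaOmega) ≤ borelSigmaAlgebra (weakTopology BetaOmega) := by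
  intro hle
  obtain ⟨p, hp⟩ := exists_parity
  have hclosed : IsClosed (betaIndicator '' {A | p A}) := by
    refine Metric.isClosed_of_pairwise_le_dist one_pos ?_
    rintro _ ⟨A, -, rfl⟩ _ ⟨B, -, rfl⟩ hAB
    exact one_le_dist_betaIndicator fun h => hAB (h ▸ rfl)
  have hZ : MeasurableSet[borelSigmaAlgebra (weakTopology BetaOmega)]
      (betaIndicator '' {A | p A}) := by
    refine hle _ (MeasurableSet.of_compl ?_)
    exact MeasurableSpace.measurableSet_generateFrom hclosed.isOpen_compl
  obtain ⟨C, hC, hCc, hZC⟩ := exists_countable_measurableSet_generateFrom hZ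
  obtain ⟨U, hU, hCU⟩ := exists_seq_of_countable_isOpen _ hC hCc
  obtain ⟨A, N, hN, hmeas⟩ := exists_graft_measurableSet_of_weak U hU
  have hgraft : Measurable[_, MeasurableSpace.generateFrom C]
      fun x => betaIndicator (graft A N x) := by
    refine @measurable_generateFrom _ _ _ C _ fun s hs => ?_
    obtain ⟨n, rfl⟩ := hCU hs
    exact hmeas n
  -- Only coordinates in `N` affect the graft, so the Cantor space is reindexed by an enumeration of
  -- `N`; then every single flip changes the parity.
  let f : ℕ → ℕ := fun k => hN.natEmbedding N k
  have hf : Function.Injective f := Subtype.val_injective.comp (hN.natEmbedding N).injective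
  have hS := measurable_extend_const hf (hgraft hZC)
  refine not_baireMeasurableSet_of_parity (fun y k => ?_) hS.baireMeasurableSet
  simp only [Set.mem_preimage, betaIndicator_injective.mem_set_image, Set.mem_ofPred_eq]
  rw [graft_extend_update hf (fun k => (hN.natEmbedding N k).2), hp]

/-! ### Comparison of the σ-algebras -/

theorem baireSigmaAlgebra_anti {X : Type*} {t t' : TopologicalSpace X} (h : t ≤ t') :
    baireSigmaAlgebra t' ≤ baireSigmaAlgebra t :=
  iSup_le fun f => le_iSup
    (fun f : {f : X → ℝ // @Continuous X ℝ t inferInstance f} =>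
      MeasurableSpace.comap f.1 (borel ℝ)) ⟨f.1, continuous_le_dom h f.2⟩

theorem borelSigmaAlgebra_anti {X : Type*} {t t' : TopologicalSpace X} (h : t ≤ t') :
    borelSigmaAlgebra t' ≤ borelSigmaAlgebra t :=
  borel_anti h

theorem measurable_baireSigmaAlgebra {X : Type*} {t : TopologicalSpace X} {f : X → ℝ}
    (hf : @Continuous X ℝ t inferInstance f) : Measurable[baireSigmaAlgebra t] f := by
  rw [measurable_iff_comap_le, BorelSpace.measurable_eq (α := ℝ)]
  exact le_iSup
    (fun f : {f : X → ℝ // @Continuous X ℝ t inferInstance f} =>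
      MeasurableSpace.comap f.1 (borel ℝ)) ⟨f, hf⟩

theorem baireSigmaAlgebra_le_borelSigmaAlgebra {X : Type*} (t : TopologicalSpace X) :
    baireSigmaAlgebra t ≤ borelSigmaAlgebra t :=
  iSup_le fun f => (@borel_comap X ℝ f.1 inferInstance).symm.trans_le
    (borel_anti (continuous_iff_le_induced.1 f.2))

theorem continuous_weakTopology (K : Type*) [TopologicalSpace K] [CompactSpace K]
    (φ : C(K, ℝ) →L[ℝ] ℝ) : @Continuous _ _ (weakTopology K) _ φ :=
  @Continuous.comp _ (WeakSpace ℝ C(K, ℝ)) _ (weakTopology K) _ _ (toWeakSpace ℝ C(K, ℝ)) _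
    (WeakBilin.eval_continuous (topDualPairing ℝ C(K, ℝ)).flip φ)
    (@continuous_induced_dom _ _ (toWeakSpace ℝ C(K, ℝ)) _)

theorem normTopology_le_weakTopology (K : Type*) [TopologicalSpace K] [CompactSpace K] :
    normTopology K ≤ weakTopology K :=
  continuous_iff_le_induced.1 (toWeakSpaceCLM ℝ C(K, ℝ)).continuous

theorem weakTopology_le_pointwiseTopology (K : Type*) [TopologicalSpace K] [CompactSpace K] :
    weakTopology K ≤ pointwiseTopology K := by
  rw [← continuous_iff_le_induced]
  exact @continuous_pi _ _ _ (weakTopology K) _ _ fun x =>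
    continuous_weakTopology K (ContinuousMap.evalCLM ℝ x)

theorem proposition5p2 :
    (∀ (ι : Type*) [Uncountable ι] (A : ι → Set ℕ) (F : ι → BetaOmega),
      IsAlmostDisjointFamily A → (∀ i, F i ∈ omegaStar) → (∀ i, A i ∈ F i) →
        IsOpen[pointwiseTopology BetaOmega] (positiveSomewhere F) ∧
        ¬ MeasurableSet[baireSigmaAlgebra (weakTopology BetaOmega)] (positiveSomewhere F)) ∧
    ¬ (borelSigmaAlgebra (pointwiseTopology BetaOmega) ≤
        baireSigmaAlgebra (weakTopology BetaOmega)) ∧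
    (baireSigmaAlgebra (pointwiseTopology BetaOmega) <
        borelSigmaAlgebra (pointwiseTopology BetaOmega) ∧
      baireSigmaAlgebra (pointwiseTopology BetaOmega) <
        baireSigmaAlgebra (weakTopology BetaOmega) ∧
      borelSigmaAlgebra (pointwiseTopology BetaOmega) <
        borelSigmaAlgebra (weakTopology BetaOmega) ∧
      baireSigmaAlgebra (weakTopology BetaOmega) <
        borelSigmaAlgebra (weakTopology BetaOmega) ∧
      borelSigmaAlgebra (weakTopology BetaOmega) <
        borelSigmaAlgebra (normTopology BetaOmega)) := by
  have hpw := weakTopology_le_pointwiseTopology BetaOmega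
  have h2 := not_borel_pointwise_le_baire_weak
  obtain ⟨Λ, hΛ⟩ := exists_not_measurable_borel_pointwise
  have hΛw : Measurable[baireSigmaAlgebra (weakTopology BetaOmega)] Λ :=
    measurable_baireSigmaAlgebra (continuous_weakTopology BetaOmega Λ)
  have hBaBor := baireSigmaAlgebra_le_borelSigmaAlgebra (pointwiseTopology BetaOmega)
  have hBaBorw := baireSigmaAlgebra_le_borelSigmaAlgebra (weakTopology BetaOmega)
  refine ⟨fun ι _ A F hA hF hAF => ⟨isOpen_positiveSomewhere F,
    not_measurableSet_positiveSomewhere hA hF hAF⟩, h2, ?_, ?_, ?_, ?_, ?_⟩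
  -- `V` separates here and for weak Baire against weak Borel; `Λ`, being weakly Baire, separates
  -- the two pointwise σ-algebras from their weak counterparts.
  · exact lt_of_le_not_ge hBaBor fun h => h2 (h.trans (baireSigmaAlgebra_anti hpw))
  · exact lt_of_le_not_ge (baireSigmaAlgebra_anti hpw) fun h =>
      hΛ (hΛw.mono (h.trans hBaBor) le_rfl)
  · exact lt_of_le_not_ge (borelSigmaAlgebra_anti hpw) fun h =>
      hΛ (hΛw.mono (hBaBorw.trans h) le_rfl)
  · exact lt_of_le_not_ge hBaBorw fun h => h2 ((borelSigmaAlgebra_anti hpw).trans h)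
  · exact lt_of_le_not_ge (borelSigmaAlgebra_anti (normTopology_le_weakTopology BetaOmega))
      not_borel_norm_le_borel_weak
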